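/- Let $k$ be any field and let $H$ be a pointed Hopf algebra over $k$, i.e. the coradical of $H$ (the sum of all simple subcoalgebras) is the linear span of the set $G(H)$ of group-like elements. Write $\Delta,\varepsilon,S$ for the comultiplication, counit and antipode, and let $H_{(0)}\subseteq H_{(1)}\subseteq\cdots$ be the coradical filtration: $H_{(0)}$ is the coradical and $H_{(n)}=\Delta^{-1}(H_{(n-1)}\otimes H+H\otimes H_{(0)})$ for $n\ge 1$. Conventions on words. Let $(O,<)$ be a well-ordered set, $D\subseteq O$, $D^*=\{x^*\mid x\in D\}$ a disjoint copy of $D$, and $X=O\sqcup D^*$. Put $o(x)=x$ for $x\in O$ and $o(x^*)=x$ for $x\in D$. Order $X$ by: $a\prec b$ iff $o(a)<o(b)$, or $o(a)=o(b)=a$ and $b=a^*$. For a nonempty word $\alpha$ over $X$ let $o(\alpha)$ be $o$ of its first letter. The reduction order $\prec_{\rm r}$ on words is: the empty word is the least word, and for nonempty words $\alpha\prec_{\rm r}\beta$ iff $o(\alpha)<o(\beta)$; or $o(\alpha)=o(\beta)$ and $|\alpha|<|\beta|$; or $o(\alpha)=o(\beta)$, $|\alpha|=|\beta|$ and $\alpha$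 is smaller than $\beta$ lexicographically with respect to $\prec$. The leading word of a nonzero $p\in k\langle X\rangle$ (the free algebra) is the $\prec_{\rm r}$-greatest word occurring in $p$ with nonzero coefficient. For an ideal $I$ of $k\langle X\rangle$, a letter $x\in X$ is $I$-irreducible if it is not the leading word of any element of $I$; $X_I$ denotes the set of $I$-irreducible letters. (a) There exist a well-ordered set $O$, a subset $D\subseteq O$ and an injective map $f\colon X=O\sqcup D^*\to H$ whose image generates $H$ as an algebra, such that, with $t(x)=\min\{n\mid f(x)\in H_{(n)}\}$ (which exists for every $x\in X$): - $\varepsilon(f(x))=0$ for all $x\in X$; - $f(\{x\in X\mid t(x)=0\})=\{1-g\mid g\in G(H)\}$; - $f(D\cup D^*)=\{1-g\mid g\in G(H)\text{ of infinite order}\}$, and $f(x^*)=S(f(x))$ for all $x\in D$ (so if $f(x)=1-g$ then $f(x^*)=1-g^{-1}$); - $t(x)<t(y)$ implies $x\prec y$ for all $x,y\in X$; - for every $x\in X$ there is $g\in G(H)$ with $$\Delta(f(x))-f(x)\otimes 1-g\otimes f(x)\in\ker\varepsilon\otimes\operatorname{span}_k\{f(y)\mid y\in X,\ t(y)<t(x)\};$$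 and, if $\pi\colon k\langle X\rangle\to H$ is the algebra homomorphism extending $f$ and $I=\ker\pi$, then $\pi(X_I)$ generates $H$ as a $k$-algebra. (b) If $H$ is right or left Noetherian, then $H$ is affine, i.e. finitely generated as a $k$-algebra. -/

import Mathlib

open scoped TensorProduct

universe u v

namespace PointedHopf

/-! ### Coradical, coradical filtration, pointed coalgebras -/

section Coalgebra

variable (k : Type*) {C : Type*} [Field k] [AddCommGroup C] [Module k C] [Coalgebra k C]

/-- `U ⊗ V`, viewed as a subspace of `C ⊗ C`. -/
def tensorSub (U V : Submodule k C) : Submodule k (C ⊗[k] C) :=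
  LinearMap.range (TensorProduct.map U.subtype V.subtype)

/-- A subspace `E` is a subcoalgebra if `Δ(E) ⊆ E ⊗ E`. -/
def IsSubcoalgebra (E : Submodule k C) : Prop :=
  E.map (Coalgebra.comul (R := k) (A := C)) ≤ tensorSub k E E

/-- A simple subcoalgebra: nonzero, with no subcoalgebras other than `0` and itself. -/
def IsSimpleSubcoalgebra (E : Submodule k C) : Prop :=
  IsSubcoalgebra k E ∧ E ≠ ⊥ ∧ ∀ F : Submodule k C, IsSubcoalgebra k F → F ≤ E → F = ⊥ ∨ F = E

variable (C)

/-- The coradical: the sum of all simple subcoalgebras. -/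
def coradical : Submodule k C :=
  sSup {E : Submodule k C | IsSimpleSubcoalgebra k E}

/-- The coradical filtration: `C₍₀₎` is the coradical and
`C₍ₙ₊₁₎ = Δ⁻¹(C₍ₙ₎ ⊗ C + C ⊗ C₍₀₎)`. -/
def coradicalFiltration : ℕ → Submodule k C
  | 0 => coradical k C
  | n + 1 => (tensorSub k (coradicalFiltration n) ⊤ ⊔ tensorSub k ⊤ (coradical k C)).comap
      (Coalgebra.comul (R := k) (A := C))

/-- `C` is pointed if its coradical is the span of the group-like elements. -/
def IsPointed : Prop :=
  coradical k C = Submodule.span k {g : C | IsGroupLikeElem k g}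

end Coalgebra

/-! ### Letters, words and the reduction order -/

section Words

variable {O : Type*} [LinearOrder O] {D : Set O}

/-- The alphabet `X = O ∪ D*`, where `D* = {x* | x ∈ D}` is a disjoint copy of `D ⊆ O`;
`Sum.inr x` is the mirror letter `x*`. -/
abbrev Letter (D : Set O) : Type _ := O ⊕ D

/-- The original element of a letter: `o(x) = x` for `x ∈ O`, and `o(x*) = x` for `x ∈ D`. -/
def orig : Letter D → O
  | Sum.inl x => x
  | Sum.inr x => x

/-- The order `≺` on letters: compare original elements, and put `x` immediately before `x*`. -/
def LetterLT (a b : Letter D) : Prop :=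
  orig a < orig b ∨ (orig a = orig b ∧ a.isLeft ∧ b.isRight)

/-- The reduction order `≺ᵣ` on words: the empty word is the least word; nonempty words are
compared first by the original element of the first letter, then by length, and then
lexicographically with respect to `≺`. -/
def RedLT : List (Letter D) → List (Letter D) → Prop
  | _, [] => False
  | [], _ :: _ => True
  | a :: u, b :: v =>
      orig a < orig b ∨
      (orig a = orig b ∧
        (u.length < v.length ∨
          (u.length = v.length ∧ List.Lex LetterLT (a :: u) (b :: v))))

/-- The coefficient of a word in a noncommutative polynomial. -/
noncomputable def wordCoeff {k X : Type*} [Field k] (p : FreeAlgebra k X) (w : List X) : k :=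
  (FreeAlgebra.equivMonoidAlgebraFreeMonoid p).coeff (FreeMonoid.ofList w)

/-- `w` is the leading word of `p`: the greatest word, in the reduction order, that appears in `p`
with a nonzero coefficient. -/
def IsLeadingWord {k : Type*} [Field k] (p : FreeAlgebra k (Letter D)) (w : List (Letter D)) :
    Prop :=
  wordCoeff p w ≠ 0 ∧ ∀ v, wordCoeff p v ≠ 0 → v ≠ w → RedLT v w

/-- `w` is `I`-reducible if it is the leading word of some element of `I`. -/
def IsReducible {k : Type*} [Field k] (I : Ideal (FreeAlgebra k (Letter D)))
    (w : List (Letter D)) : Prop :=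
  ∃ p ∈ I, IsLeadingWord p w

/-- The set `X_I` of `I`-irreducible letters. -/
def irreducibleLetters {k : Type*} [Field k] (I : Ideal (FreeAlgebra k (Letter D))) :
    Set (Letter D) :=
  {x | ¬ IsReducible I [x]}

end Words

/-! ### Generating sets adapted to the coradical filtration -/

section Hopf

variable (k : Type*) {H : Type*} [Field k] [Ring H] [HopfAlgebra k H]
  {O : Type*} [LinearOrder O] {D : Set O}

/-- The alphabet `X = O ∪ D*`, with the (injective) assignment `f : X → H` and the degree map
`t : X → ℕ`, is a generating set of `H` built from the elements `1 - g`, `g` group-like, and from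
the coradical filtration. -/
structure IsAdaptedGeneratingSet (f : Letter D → H) (t : Letter D → ℕ) : Prop where
  injective : Function.Injective f
  /-- `f(X)` generates `H` as an algebra. -/
  adjoin_range : Algebra.adjoin k (Set.range f) = ⊤
  counit_eq_zero : ∀ x, Coalgebra.counit (R := k) (f x) = 0
  /-- `t(x)` is the least `n` such that `f(x)` lies in the `n`-th term of the coradical
  filtration. -/
  degree : ∀ x, IsLeast {n : ℕ | f x ∈ coradicalFiltration k H n} (t x)
  /-- The letters of degree `0` are the elements `1 - g` with `g` group-like. -/
  image_degree_zero : f '' {x | t x = 0} = {v | ∃ g : H, IsGroupLikeElem k g ∧ v = 1 - g}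
  /-- `D` and `D*` together are the elements `1 - g` with `g` group-like of infinite order. -/
  image_infinite_order : f '' {x | orig x ∈ D} =
    {v | ∃ g : H, IsGroupLikeElem k g ∧ ¬ IsOfFinOrder g ∧ v = 1 - g}
  /-- If `x ∈ D` is `1 - g`, then `x*` is `1 - g⁻¹`. -/
  mirror : ∀ x : D, f (Sum.inr x) = HopfAlgebra.antipode k (f (Sum.inl (x : O)))
  /-- Letters of smaller degree come first. -/
  lt_of_degree_lt : ∀ x y, t x < t y → LetterLT x y
  /-- Every letter is skew primitive up to a sum of terms `h ⊗ f(y)` with `ε(h) = 0` and `y` of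
  smaller degree. -/
  comul : ∀ x, ∃ g : H, IsGroupLikeElem k g ∧
    Coalgebra.comul (R := k) (f x) - f x ⊗ₜ[k] 1 - g ⊗ₜ[k] f x ∈
      tensorSub k (LinearMap.ker (Coalgebra.counit (R := k) (A := H)))
        (Submodule.span k (f '' {y | t y < t x}))

end Hopf

end PointedHopf

/-! The engine is a freeness phenomenon. Call `h` skew modulo a left coideal `N` if `Δ(h) ≡ g ⊗ h`
modulo `H ⊗ N` for some group-like `g`. Pointedness supplies such elements in any left coideal not
contained in `N` (`SubcoalgebrasHaveGroupLike.exists_isSkewModulo`). Let `B` be a left coideal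
subalgebra in which every group-like element of `B` is invertible, and let `N` also be a
`B`-submodule. If `h ∉ N` is skew modulo `N`, then `(N + Bh)/N` is free on `h`
(`eq_zero_of_mul_mem`). Building `H` from `M` by such free steps gives `B⁺H ∩ M = B⁺M`
(`augPart_mul_top_inf_le`). Hence a skew element modulo `N` lying in `N + B⁺H` already lies in `N`
(`mem_of_isSkewModulo`).

Apply this with `B` generated by the letters whose original element is below that of `x`. Each word
below `x` is empty, starts with a letter of `B⁺`, or is the partner `d` when `x = d*`. So if `x` is
reducible, its value lies in `B`, or in `B + B f(d)`, modulo `B⁺H`, and the congruence can be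
dropped. Well-founded induction then shows that the irreducible letters generate. The mirror letters
are there to make the group-like elements of `B` invertible in `B`.

If `H` is right Noetherian, the right ideals generated by initial segments of letters grow strictly
at only finitely many original elements. At any other original element the letter lies in `B⁺H`,
hence in `B`, so finitely many letters generate. The left Noetherian case follows by reversing both
the multiplication and the comultiplication.

The letters themselves are all elements of augmentation zero that are `1 - g` in degree `0` and skew
modulo the previous term of the filtration in higher degree. -/

namespace PointedHopf

/-! ### Slicing tensors by functionals -/

section Slices

variable {k C : Type*} [Field k] [AddCommGroup C] [Module k C]

/-- Apply a functional to the left tensor factor. -/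
noncomputable def lslice (φ : Module.Dual k C) : C ⊗[k] C →ₗ[k] C :=
  (TensorProduct.lid k C).toLinearMap ∘ₗ φ.rTensor C

/-- Apply a functional to the right tensor factor. -/
noncomputable def rslice (φ : Module.Dual k C) : C ⊗[k] C →ₗ[k] C :=
  (TensorProduct.rid k C).toLinearMap ∘ₗ φ.lTensor C

@[simp] lemma lslice_tmul (φ : Module.Dual k C) (a b : C) : lslice φ (a ⊗ₜ[k] b) = φ a • b := by
  simp [lslice]

@[simp] lemma rslice_tmul (φ : Module.Dual k C) (a b : C) : rslice φ (a ⊗ₜ[k] b) = φ b • a := by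
  simp [rslice]

lemma lslice_comm (φ : Module.Dual k C) (t : C ⊗[k] C) :
    lslice φ (TensorProduct.comm k C C t) = rslice φ t := by
  induction t with
  | zero => simp
  | tmul a b => simp
  | add s t hs ht => simp [hs, ht]

lemma exists_eq_sum_lslice {ι : Type*} (b : Module.Basis ι k C) (t : C ⊗[k] C) :
    ∃ s : Finset ι, t = ∑ i ∈ s, b i ⊗ₜ[k] lslice (b.coord i) t := by
  classical
  set c := TensorProduct.equivFinsuppOfBasisLeft (N := C) b t with hc
  refine ⟨c.support, ?_⟩
  have h1 : t = c.sum fun i n => b i ⊗ₜ[k] n := by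
    rw [← TensorProduct.equivFinsuppOfBasisLeft_symm_apply, hc, LinearEquiv.symm_apply_apply]
  conv_lhs => rw [h1]
  refine Finset.sum_congr rfl fun i _ => ?_
  rw [hc, TensorProduct.equivFinsuppOfBasisLeft_apply]
  rfl

lemma tmul_mem_tensorSub {U V : Submodule k C} {a b : C} (ha : a ∈ U) (hb : b ∈ V) :
    a ⊗ₜ[k] b ∈ tensorSub k U V :=
  ⟨(⟨a, ha⟩ : U) ⊗ₜ (⟨b, hb⟩ : V), by simp⟩

lemma tensorSub_le {U V : Submodule k C} {P : Submodule k (C ⊗[k] C)}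
    (h : ∀ a ∈ U, ∀ b ∈ V, a ⊗ₜ[k] b ∈ P) : tensorSub k U V ≤ P := by
  rintro _ ⟨t, rfl⟩
  induction t with
  | zero => simp
  | tmul a b => simpa using h a a.2 b b.2
  | add s t hs ht => rw [map_add]; exact P.add_mem hs ht

lemma mem_tensorSub_top_left {V : Submodule k C} {t : C ⊗[k] C} :
    t ∈ tensorSub k ⊤ V ↔ ∀ φ, lslice φ t ∈ V := by
  constructor
  · intro h φ
    have : tensorSub k ⊤ V ≤ V.comap (lslice φ) :=
      tensorSub_le fun a _ b hb => by simpa using V.smul_mem _ hb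
    exact this h
  · intro h
    obtain ⟨s, hs⟩ := exists_eq_sum_lslice (Module.Basis.ofVectorSpace k C) t
    rw [hs]
    exact Submodule.sum_mem _ fun i _ => tmul_mem_tensorSub trivial (h _)

lemma comm_mem_tensorSub {U V : Submodule k C} {t : C ⊗[k] C} (h : t ∈ tensorSub k U V) :
    TensorProduct.comm k C C t ∈ tensorSub k V U := by
  have : tensorSub k U V ≤ (tensorSub k V U).comap (TensorProduct.comm k C C).toLinearMap :=
    tensorSub_le fun a ha b hb => by simpa using tmul_mem_tensorSub hb ha
  exact this h

lemma comm_mem_tensorSub_iff {U V : Submodule k C} {t : C ⊗[k] C} :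
    TensorProduct.comm k C C t ∈ tensorSub k V U ↔ t ∈ tensorSub k U V := by
  refine ⟨fun h => ?_, comm_mem_tensorSub⟩
  have := comm_mem_tensorSub h
  rwa [TensorProduct.comm_comm] at this

lemma mem_tensorSub_top_right {U : Submodule k C} {t : C ⊗[k] C} :
    t ∈ tensorSub k U ⊤ ↔ ∀ φ, rslice φ t ∈ U := by
  rw [← comm_mem_tensorSub_iff, mem_tensorSub_top_left]
  simp [lslice_comm]

lemma exists_projection (U : Submodule k C) :
    ∃ p : C →ₗ[k] C, (∀ x, p x ∈ U) ∧ ∀ x ∈ U, p x = x := by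
  obtain ⟨q, hq⟩ := U.subtype.exists_leftInverse_of_injective (by simp)
  refine ⟨U.subtype ∘ₗ q, fun x => (q x).2, fun x hx => ?_⟩
  have := LinearMap.congr_fun hq ⟨x, hx⟩
  simp only [LinearMap.comp_apply, LinearMap.id_apply] at this
  simp only [Submodule.subtype_apply] at this
  simp [this]

lemma rslice_lTensor (φ : Module.Dual k C) (q : C →ₗ[k] C) (t : C ⊗[k] C) :
    rslice φ (q.lTensor C t) = rslice (φ ∘ₗ q) t := by
  induction t with
  | zero => simp
  | tmul a b => simp
  | add s t hs ht => simp [hs, ht]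

lemma lslice_lTensor (φ : Module.Dual k C) (q : C →ₗ[k] C) (t : C ⊗[k] C) :
    lslice φ (q.lTensor C t) = q (lslice φ t) := by
  induction t with
  | zero => simp
  | tmul a b => simp
  | add s t hs ht => simp [hs, ht]

/-- A projection `p` onto `V` splits `t` in its right factor. The `p` part lies in `C ⊗ V`, and
functionals composed with `id - p` kill `V`, so the hypothesis controls the remainder. -/
lemma mem_sup_tensorSub {U V : Submodule k C} {t : C ⊗[k] C} :
    t ∈ tensorSub k U ⊤ ⊔ tensorSub k ⊤ V ↔
      ∀ ψ : Module.Dual k C, (∀ v ∈ V, ψ v = 0) → rslice ψ t ∈ U := by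
  constructor
  · intro h ψ hψ
    have h1 : tensorSub k U ⊤ ≤ U.comap (rslice ψ) :=
      tensorSub_le fun a ha b _ => by simpa using U.smul_mem _ ha
    have h2 : tensorSub k ⊤ V ≤ U.comap (rslice ψ) :=
      tensorSub_le fun a _ b hb => by simp [hψ b hb]
    exact sup_le h1 h2 h
  · intro h
    obtain ⟨p, hp, hpV⟩ := exists_projection V
    have ht : t = (LinearMap.id - p).lTensor C t + p.lTensor C t := by
      simp [LinearMap.lTensor_sub]
    rw [ht]
    refine Submodule.add_mem_sup ?_ ?_
    · rw [mem_tensorSub_top_right]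
      intro φ
      rw [rslice_lTensor]
      exact h _ fun v hv => by simp [hpV v hv]
    · rw [mem_tensorSub_top_left]
      intro φ
      rw [lslice_lTensor]
      exact hp _

lemma mem_tensorSub {U V : Submodule k C} {t : C ⊗[k] C} :
    t ∈ tensorSub k U V ↔ t ∈ tensorSub k U ⊤ ∧ t ∈ tensorSub k ⊤ V := by
  constructor
  · intro h
    exact ⟨tensorSub_le (fun a ha b _ => tmul_mem_tensorSub ha Submodule.mem_top) h,
      tensorSub_le (fun a _ b hb => tmul_mem_tensorSub Submodule.mem_top hb) h⟩
  · rintro ⟨h1, h2⟩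
    obtain ⟨p, hp, hpV⟩ := exists_projection V
    have h3 : tensorSub k ⊤ V ≤ LinearMap.eqLocus (p.lTensor C) LinearMap.id :=
      tensorSub_le fun a _ b hb => by simp [LinearMap.mem_eqLocus, hpV b hb]
    have h4 : tensorSub k U ⊤ ≤ (tensorSub k U V).comap (p.lTensor C) :=
      tensorSub_le fun a ha b _ => by simpa using tmul_mem_tensorSub ha (hp b)
    have h5 := h3 h2
    rw [LinearMap.mem_eqLocus, LinearMap.id_apply] at h5
    rw [← h5]
    exact h4 h1

lemma finite_lslice (t : C ⊗[k] C) :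
    ∃ F : Submodule k C, FiniteDimensional k F ∧ ∀ φ, lslice φ t ∈ F := by
  induction t with
  | zero => exact ⟨⊥, inferInstance, by simp⟩
  | tmul a b =>
    exact ⟨Submodule.span k {b}, inferInstance, fun φ => by
      simpa using Submodule.smul_mem _ _ (Submodule.mem_span_singleton_self b)⟩
  | add s t hs ht =>
    obtain ⟨F, hF, h⟩ := hs
    obtain ⟨F', hF', h'⟩ := ht
    exact ⟨F ⊔ F', inferInstance, fun φ => by
      rw [map_add]; exact Submodule.add_mem_sup (h φ) (h' φ)⟩

lemma finite_rslice (t : C ⊗[k] C) :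
    ∃ F : Submodule k C, FiniteDimensional k F ∧ ∀ φ, rslice φ t ∈ F := by
  obtain ⟨F, hF, h⟩ := finite_lslice (TensorProduct.comm k C C t)
  exact ⟨F, hF, fun φ => by simpa [lslice_comm] using h φ⟩

end Slices

/-! ### The two actions of the dual, and coideals -/

section Actions

variable {k C : Type*} [Field k] [AddCommGroup C] [Module k C] [Coalgebra k C]

/-- `h ↦ φ(h₁) h₂`. -/
noncomputable def lact (φ : Module.Dual k C) : C →ₗ[k] C := lslice φ ∘ₗ Coalgebra.comul

/-- `h ↦ φ(h₂) h₁`. -/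
noncomputable def ract (φ : Module.Dual k C) : C →ₗ[k] C := rslice φ ∘ₗ Coalgebra.comul

lemma lact_apply (φ : Module.Dual k C) (h : C) : lact φ h = lslice φ (Coalgebra.comul h) := rfl

lemma ract_apply (φ : Module.Dual k C) (h : C) : ract φ h = rslice φ (Coalgebra.comul h) := rfl

@[simp] lemma lact_counit (h : C) : lact (Coalgebra.counit : C →ₗ[k] k) h = h := by
  simp [lact, lslice]

@[simp] lemma ract_counit (h : C) : ract (Coalgebra.counit : C →ₗ[k] k) h = h := by
  simp [ract, rslice]

lemma lact_sub (φ ψ : Module.Dual k C) (h : C) : lact (φ - ψ) h = lact φ h - lact ψ h := by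
  simp [lact, lslice, LinearMap.rTensor_sub]

lemma lact_smul (a : k) (φ : Module.Dual k C) (h : C) : lact (a • φ) h = a • lact φ h := by
  simp [lact, lslice, LinearMap.rTensor_smul]

/-- Both sides are `φ(h₁)ψ(h₂)`. This transposition lets later identities be checked by pairing with
functionals. -/
lemma dual_lact (φ ψ : Module.Dual k C) (h : C) : ψ (lact φ h) = φ (ract ψ h) := by
  rw [lact_apply, ract_apply]
  induction (Coalgebra.comul h : C ⊗[k] C) with
  | zero => simp
  | tmul a b => simp [mul_comm]
  | add s t hs ht => simp [hs, ht]

lemma counit_lact (φ : Module.Dual k C) (h : C) :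
    Coalgebra.counit (R := k) (lact φ h) = φ h := by
  rw [dual_lact, ract_counit]

/-- Apply functionals to the first and third factors of a triple tensor. -/
noncomputable def outerSlice (φ ψ : Module.Dual k C) : C ⊗[k] (C ⊗[k] C) →ₗ[k] C :=
  rslice ψ ∘ₗ (TensorProduct.lid k (C ⊗[k] C)).toLinearMap ∘ₗ φ.rTensor (C ⊗[k] C)

/-- By coassociativity both sides are `φ(h₁)ψ(h₃)h₂`. -/
lemma lact_ract (φ ψ : Module.Dual k C) (h : C) : lact φ (ract ψ h) = ract ψ (lact φ h) := by
  have h1 : ∀ t : C ⊗[k] C, ract ψ (lslice φ t) =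
      outerSlice φ ψ (Coalgebra.comul.lTensor C t) := by
    intro t
    induction t with
    | zero => simp
    | tmul a b => simp [outerSlice, ract_apply]
    | add s t hs ht => simp [hs, ht]
  have h2 : ∀ t : C ⊗[k] C, lact φ (rslice ψ t) =
      outerSlice φ ψ (TensorProduct.assoc k C C C (Coalgebra.comul.rTensor C t)) := by
    intro t
    induction t with
    | zero => simp
    | tmul a b =>
      simp only [rslice_tmul, map_smul, LinearMap.rTensor_tmul, lact_apply]
      induction (Coalgebra.comul a : C ⊗[k] C) with
      | zero => simp
      | tmul c d => simp [outerSlice, smul_comm (ψ b)]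
      | add s t hs ht => simp [TensorProduct.add_tmul, hs, ht]
    | add s t hs ht => simp [hs, ht]
  rw [ract_apply, h2, lact_apply, h1, Coalgebra.coassoc_apply]

lemma lact_lact (φ ψ : Module.Dual k C) (h : C) :
    lact φ (lact ψ h) = lact (φ ∘ₗ lact ψ) h := by
  refine sub_eq_zero.1 ((Module.forall_dual_apply_eq_zero_iff k _).1 fun χ => ?_)
  rw [map_sub, dual_lact φ χ, ← lact_ract, dual_lact _ χ, LinearMap.comp_apply, sub_self]

/-- A left coideal: `Δ(N) ⊆ C ⊗ N`. -/
def IsLeftCoideal (N : Submodule k C) : Prop := ∀ φ : Module.Dual k C, ∀ h ∈ N, lact φ h ∈ N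

/-- A right coideal: `Δ(N) ⊆ N ⊗ C`. -/
def IsRightCoideal (N : Submodule k C) : Prop := ∀ φ : Module.Dual k C, ∀ h ∈ N, ract φ h ∈ N

lemma isSubcoalgebra_iff {E : Submodule k C} :
    IsSubcoalgebra k E ↔ IsLeftCoideal E ∧ IsRightCoideal E := by
  constructor
  · intro h
    exact ⟨fun φ x hx => mem_tensorSub_top_left.1 (mem_tensorSub.1 (h ⟨x, hx, rfl⟩)).2 φ,
      fun φ x hx => mem_tensorSub_top_right.1 (mem_tensorSub.1 (h ⟨x, hx, rfl⟩)).1 φ⟩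
  · rintro ⟨h1, h2⟩ _ ⟨x, hx, rfl⟩
    exact mem_tensorSub.2 ⟨mem_tensorSub_top_right.2 fun φ => h2 φ x hx,
      mem_tensorSub_top_left.2 fun φ => h1 φ x hx⟩

end Actions

end PointedHopf

namespace PointedHopf

/-! ### Pointedness and skew elements modulo a coideal -/

section Coideals

variable {k C : Type*} [Field k] [AddCommGroup C] [Module k C] [Coalgebra k C]

lemma ract_ract (φ ψ : Module.Dual k C) (h : C) :
    ract φ (ract ψ h) = ract (φ ∘ₗ ract ψ) h := by
  refine sub_eq_zero.1 ((Module.forall_dual_apply_eq_zero_iff k _).1 fun χ => ?_)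
  rw [map_sub, ← dual_lact χ φ, lact_ract, ← dual_lact χ, LinearMap.comp_apply, sub_self]

lemma _root_.IsGroupLikeElem.lact_eq {g : C} (hg : IsGroupLikeElem k g) (φ : Module.Dual k C) :
    lact φ g = φ g • g := by
  rw [lact_apply, hg.comul_eq_tmul_self, lslice_tmul]

lemma _root_.IsGroupLikeElem.ract_eq {g : C} (hg : IsGroupLikeElem k g) (φ : Module.Dual k C) :
    ract φ g = φ g • g := by
  rw [ract_apply, hg.comul_eq_tmul_self, rslice_tmul]

lemma IsLeftCoideal.iSup {ι : Sort*} {N : ι → Submodule k C} (h : ∀ i, IsLeftCoideal (N i)) :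
    IsLeftCoideal (⨆ i, N i) := fun φ =>
  show (⨆ i, N i) ≤ (⨆ i, N i).comap (lact φ) from
    iSup_le fun i _ hx => Submodule.mem_iSup_of_mem i (h i φ _ hx)

lemma IsLeftCoideal.span {s : Set C}
    (h : ∀ φ : Module.Dual k C, ∀ x ∈ s, lact φ x ∈ Submodule.span k s) :
    IsLeftCoideal (Submodule.span k s) := fun φ =>
  show Submodule.span k s ≤ (Submodule.span k s).comap (lact φ) from
    Submodule.span_le.2 fun x hx => h φ x hx

lemma IsRightCoideal.span {s : Set C}
    (h : ∀ φ : Module.Dual k C, ∀ x ∈ s, ract φ x ∈ Submodule.span k s) :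
    IsRightCoideal (Submodule.span k s) := fun φ =>
  show Submodule.span k s ≤ (Submodule.span k s).comap (ract φ) from
    Submodule.span_le.2 fun x hx => h φ x hx

lemma IsLeftCoideal.inf {N M : Submodule k C} (hN : IsLeftCoideal N) (hM : IsLeftCoideal M) :
    IsLeftCoideal (N ⊓ M) :=
  fun φ x hx => ⟨hN φ x hx.1, hM φ x hx.2⟩

lemma isLeftCoideal_span_groupLike {s : Set C} (hs : ∀ g ∈ s, IsGroupLikeElem k g) :
    IsLeftCoideal (Submodule.span k s) :=
  .span fun φ g hg => by
    rw [(hs g hg).lact_eq]; exact Submodule.smul_mem _ _ (Submodule.subset_span hg)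

lemma isRightCoideal_span_groupLike {s : Set C} (hs : ∀ g ∈ s, IsGroupLikeElem k g) :
    IsRightCoideal (Submodule.span k s) :=
  .span fun φ g hg => by
    rw [(hs g hg).ract_eq]; exact Submodule.smul_mem _ _ (Submodule.subset_span hg)

lemma finite_lact_of_finite (F : Submodule k C) [FiniteDimensional k F] :
    ∃ F' : Submodule k C, FiniteDimensional k F' ∧
      ∀ φ : Module.Dual k C, ∀ x ∈ F, lact φ x ∈ F' := by
  obtain ⟨s, rfl⟩ := (Submodule.fg_iff_finiteDimensional F).2 inferInstance
  choose f hf hf' using fun x : C => finite_lslice (k := k) (Coalgebra.comul (R := k) x)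
  refine ⟨⨆ x ∈ s, f x, Submodule.finiteDimensional_finset_sup s f |> fun h => ?_, fun φ => ?_⟩
  · rwa [Finset.sup_eq_iSup] at h
  · have : Submodule.span k (s : Set C) ≤ (⨆ x ∈ s, f x).comap (lact φ) :=
      Submodule.span_le.2 fun x hx =>
        (le_iSup₂ (f := fun x (_ : x ∈ s) => f x) x hx) (hf' x φ)
    exact fun x hx => this hx

/-- Local finiteness of coalgebras. -/
lemma exists_finite_subcoalgebra (c : C) :
    ∃ F : Submodule k C, FiniteDimensional k F ∧ IsLeftCoideal F ∧ IsRightCoideal F ∧ c ∈ F ∧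
      ∀ E : Submodule k C, IsLeftCoideal E → IsRightCoideal E → c ∈ E → F ≤ E := by
  obtain ⟨F₁, _, hF₁⟩ := finite_rslice (k := k) (Coalgebra.comul (R := k) c)
  obtain ⟨F₂, _, hF₂⟩ := finite_lact_of_finite F₁
  -- The middle factors `φ(c₁)ψ(c₃)c₂` are stable under both actions.
  set s : Set C := {x | ∃ φ ψ : Module.Dual k C, x = lact φ (ract ψ c)} with hs
  refine ⟨Submodule.span k s, ?_, .span ?_, .span ?_, ?_, ?_⟩
  · refine Submodule.finiteDimensional_of_le (S₂ := F₂) (Submodule.span_le.2 ?_)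
    rintro _ ⟨φ, ψ, rfl⟩
    exact hF₂ _ _ (hF₁ ψ)
  · rintro χ _ ⟨φ, ψ, rfl⟩
    exact Submodule.subset_span ⟨_, ψ, lact_lact _ _ _⟩
  · rintro χ _ ⟨φ, ψ, rfl⟩
    rw [← lact_ract, ract_ract]
    exact Submodule.subset_span ⟨_, _, rfl⟩
  · exact Submodule.subset_span ⟨Coalgebra.counit, Coalgebra.counit, by simp⟩
  · intro E hl hr hc
    refine Submodule.span_le.2 ?_
    rintro _ ⟨φ, ψ, rfl⟩
    exact hl _ _ (hr _ _ hc)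

variable (k C) in
/-- The group-like elements extend to a basis. -/
lemma exists_basis_groupLike :
    ∃ (s : Set C) (b : Module.Basis s k C), 
      ∀ (i : s) (g : C), IsGroupLikeElem k g → (i : C) ≠ g → b.coord i g = 0 := by
  classical
  have h : LinearIndepOn k id {a : C | IsGroupLikeElem k a} := linearIndepOn_isGroupLikeElem
  have hs : ∀ g : C, ∀ hg : IsGroupLikeElem k g,
      Module.Basis.extend h ⟨g, Module.Basis.subset_extend h hg⟩ = g :=
    fun g hg => Module.Basis.extend_apply_self h _
  refine ⟨_, Module.Basis.extend h, fun i g hg hne => ?_⟩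
  rw [← hs g hg, Module.Basis.coord_apply, Module.Basis.repr_self, Finsupp.single_apply, if_neg]
  exact fun h => hne (by rw [← h])

variable (k C) in
/-- Every nonzero subcoalgebra contains a group-like element. -/
def SubcoalgebrasHaveGroupLike : Prop :=
  ∀ E : Submodule k C, E ≠ ⊥ → IsLeftCoideal E → IsRightCoideal E → ∃ g ∈ E, IsGroupLikeElem k g

/-- On the span of the group-like elements, a coordinate functional acts as the projection onto one
group-like line. A left coideal therefore contains each group-like element that occurs in one of its
elements. -/
lemma exists_groupLike_of_le_span {E : Submodule k C} (hE : E ≠ ⊥) (hl : IsLeftCoideal E)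
    (hle : E ≤ Submodule.span k {g : C | IsGroupLikeElem k g}) :
    ∃ g ∈ E, IsGroupLikeElem k g := by
  obtain ⟨s, b, hcoord⟩ := exists_basis_groupLike k C
  obtain ⟨e, he, he0⟩ := E.ne_bot_iff.1 hE
  obtain ⟨i, hi⟩ : ∃ i, b.coord i e ≠ 0 := by
    by_contra! h
    exact he0 (b.ext_elem fun i => by simpa using h i)
  have hig : IsGroupLikeElem k (i : C) := by
    by_contra hni
    have : Submodule.span k {g : C | IsGroupLikeElem k g} ≤ LinearMap.ker (b.coord i) :=
      Submodule.span_le.2 fun g hg => hcoord i g hg fun h => hni (h ▸ hg)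
    exact hi (this (hle he))
  have key : ∀ x ∈ Submodule.span k {g : C | IsGroupLikeElem k g},
      lact (b.coord i) x = b.coord i x • (i : C) := by
    intro x hx
    induction hx using Submodule.span_induction with
    | mem g hg =>
      rw [hg.lact_eq]
      by_cases h : (i : C) = g
      · rw [h]
      · simp [hcoord i g hg h]
    | zero => simp
    | add x y _ _ hx hy => rw [map_add, map_add, hx, hy, add_smul]
    | smul a x _ hx => rw [map_smul, map_smul, hx, smul_assoc]
  have h1 := hl (b.coord i) e he
  rw [key e (hle he)] at h1
  exact ⟨i, (Submodule.smul_mem_iff _ hi).1 h1, hig⟩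

lemma exists_simple_subcoalgebra {E : Submodule k C} (hE : E ≠ ⊥) (hl : IsLeftCoideal E)
    (hr : IsRightCoideal E) : ∃ F ≤ E, IsSimpleSubcoalgebra k F := by
  obtain ⟨e, he, he0⟩ := E.ne_bot_iff.1 hE
  obtain ⟨F₀, hfd, hFl, hFr, heF, hFE⟩ := exists_finite_subcoalgebra (k := k) e
  obtain ⟨F, ⟨hF0, hF1, hF2⟩, hmin⟩ :=
    (measure fun F : Submodule k C => Module.finrank k F).wf.has_min
      {F | F ≤ F₀ ∧ IsSubcoalgebra k F ∧ F ≠ ⊥}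
      ⟨F₀, le_rfl, isSubcoalgebra_iff.2 ⟨hFl, hFr⟩, fun h => he0 (by simpa [h] using heF)⟩
  refine ⟨F, hF0.trans (hFE E hl hr he), hF1, hF2, fun F' hF' hle => ?_⟩
  by_contra! h
  have : FiniteDimensional k F := Submodule.finiteDimensional_of_le hF0
  exact hmin F' ⟨hle.trans hF0, hF', h.1⟩
    (Submodule.finrank_lt_finrank_of_lt (lt_of_le_of_ne hle h.2))

/-- Every nonzero subcoalgebra contains a simple one by local finiteness, and under either condition
the simple ones are lines spanned by group-like elements. -/
lemma isPointed_iff : IsPointed k C ↔ SubcoalgebrasHaveGroupLike k C := by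
  constructor
  · intro hp E hE hl hr
    obtain ⟨F, hFE, hF⟩ := exists_simple_subcoalgebra hE hl hr
    have hle : F ≤ Submodule.span k {g : C | IsGroupLikeElem k g} := by
      rw [← show coradical k C = _ from hp]
      exact le_sSup hF
    obtain ⟨g, hg, hg'⟩ :=
      exists_groupLike_of_le_span hF.2.1 (isSubcoalgebra_iff.1 hF.1).1 hle
    exact ⟨g, hFE hg, hg'⟩
  · intro h
    have hsub : ∀ g : C, IsGroupLikeElem k g → IsSubcoalgebra k (Submodule.span k {g}) :=
      fun g hg => isSubcoalgebra_iff.2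
        ⟨isLeftCoideal_span_groupLike (by simpa using hg),
          isRightCoideal_span_groupLike (by simpa using hg)⟩
    refine le_antisymm (sSup_le fun E hE => ?_) (Submodule.span_le.2 fun g hg => ?_)
    · obtain ⟨g, hgE, hg⟩ := h E hE.2.1 (isSubcoalgebra_iff.1 hE.1).1 (isSubcoalgebra_iff.1 hE.1).2
      have hle : Submodule.span k {g} ≤ E := (Submodule.span_singleton_le_iff_mem _ _).2 hgE
      rcases hE.2.2 _ (hsub g hg) hle with h0 | h0
      · exact absurd (Submodule.span_singleton_eq_bot.1 h0) hg.ne_zero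
      · rw [← h0]
        exact Submodule.span_mono (by simpa using hg)
    · have hatom : IsAtom (Submodule.span k {g}) := nonzero_span_atom g hg.ne_zero
      have hsimple : IsSimpleSubcoalgebra k (Submodule.span k {g}) :=
        ⟨hsub g hg, hatom.1, fun F _ hF => hatom.le_iff.1 hF⟩
      exact (le_sSup hsimple : _ ≤ coradical k C) (Submodule.mem_span_singleton_self g)

/-- `h` spans a one-dimensional subcomodule modulo the left coideal `N`. -/
def IsSkewModulo (N : Submodule k C) (h : C) : Prop :=
  ∃ g, IsGroupLikeElem k g ∧ ∀ φ : Module.Dual k C, lact φ h - φ g • h ∈ N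

/-- A left coideal that is not contained in `N` contains a one-dimensional subcomodule
modulo `N`. -/
lemma SubcoalgebrasHaveGroupLike.exists_isSkewModulo (hC : SubcoalgebrasHaveGroupLike k C)
    {N W : Submodule k C} (hN : IsLeftCoideal N) (hW : IsLeftCoideal W) (hWN : ¬ W ≤ N) :
    ∃ w ∈ W, w ∉ N ∧ IsSkewModulo N w := by
  classical
  obtain ⟨x, hxW, hxN⟩ := SetLike.not_le_iff_exists.1 hWN
  obtain ⟨F, hfd, hFl, _, hxF, _⟩ := exists_finite_subcoalgebra (k := k) x
  -- Minimal dimension makes the image of `V` modulo `N` a simple comodule.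
  obtain ⟨V, ⟨hVF, hV, hVN⟩, hmin⟩ :=
    (measure fun F : Submodule k C => Module.finrank k F).wf.has_min
      {V | V ≤ W ⊓ F ∧ IsLeftCoideal V ∧ ¬ V ≤ N}
      ⟨W ⊓ F, le_rfl, hW.inf hFl, fun h => hxN (h ⟨hxW, hxF⟩)⟩
  have hsimple : ∀ U ≤ V, IsLeftCoideal U → U ≤ N ∨ U = V := by
    intro U hUV hU
    by_contra! h
    have : FiniteDimensional k V := Submodule.finiteDimensional_of_le (hVF.trans inf_le_right)
    exact hmin U ⟨hUV.trans hVF, hU, h.1⟩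
      (Submodule.finrank_lt_finrank_of_lt (lt_of_le_of_ne hUV h.2))
  -- `Ψ` is the dual of `C/N`. The sum of the spaces `ract ψ V` is the coefficient coalgebra of
  -- `V/(V ∩ N)`, so it contains a group-like element `g`.
  let Ψ := {ψ : Module.Dual k C // ∀ n ∈ N, ψ n = 0}
  have hmap : ∀ ψ : Ψ, IsLeftCoideal (V.map (ract ψ.1)) := by
    rintro ψ φ _ ⟨v, hv, rfl⟩
    exact ⟨lact φ v, hV φ v hv, (lact_ract _ _ _).symm⟩
  have hr : IsRightCoideal (⨆ ψ : Ψ, V.map (ract ψ.1)) := by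
    intro φ
    suffices h : (⨆ ψ : Ψ, V.map (ract ψ.1)) ≤
        (⨆ ψ : Ψ, V.map (ract ψ.1)).comap (ract φ) from fun x hx => h hx
    refine iSup_le fun ψ => ?_
    rintro _ ⟨v, hv, rfl⟩
    have hφψ : ∀ n ∈ N, (φ ∘ₗ ract ψ.1) n = 0 := fun n hn => by
      rw [LinearMap.comp_apply, ← dual_lact]
      exact ψ.2 _ (hN _ _ hn)
    rw [Submodule.mem_comap, ract_ract]
    exact Submodule.mem_iSup_of_mem (⟨_, hφψ⟩ : Ψ) ⟨v, hv, rfl⟩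
  have hne : (⨆ ψ : Ψ, V.map (ract ψ.1)) ≠ ⊥ := by
    obtain ⟨v, hv, hvN⟩ := SetLike.not_le_iff_exists.1 hVN
    obtain ⟨ψ, hψ, hψN⟩ := N.exists_le_ker_of_notMem hvN
    intro hbot
    have : ract ψ v ∈ ⨆ ψ : Ψ, V.map (ract ψ.1) :=
      Submodule.mem_iSup_of_mem (⟨ψ, fun n hn => hψN hn⟩ : Ψ) ⟨v, hv, rfl⟩
    rw [hbot, Submodule.mem_bot] at this
    apply hψ
    rw [← lact_counit (k := k) v, dual_lact, this, map_zero]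
  obtain ⟨g, hg, hgl⟩ := hC _ hne (.iSup hmap) hr
  obtain ⟨s, hs⟩ := Submodule.mem_iSup_iff_exists_finset.1 hg
  clear hg
  induction s using Finset.cons_induction with
  | empty => exact absurd (by simpa using hs) hgl.ne_zero
  | cons ψ s hψ ih =>
    by_cases hgs : g ∈ ⨆ i ∈ s, V.map (ract i.1)
    · exact ih hgs
    -- Here `ψ` is needed to reach `g`. By simplicity `ract ψ` induces an injective map from `V/(V ∩
    -- N)` to `C/N'`, and a preimage `w` of the class of `g` is skew with group-like element `g`.
    · set N' := ⨆ i ∈ s, V.map (ract i.1) with hN'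
      have hN'l : IsLeftCoideal N' := .iSup fun i => .iSup fun _ => hmap i
      rw [Finset.cons_eq_insert, Finset.iSup_insert, Submodule.mem_sup] at hs
      obtain ⟨_, ⟨w, hw, rfl⟩, n, hn, hwn⟩ := hs
      have hwN' : ract ψ.1 w ∉ N' := fun h => hgs (hwn ▸ N'.add_mem h hn)
      have hU : ∀ v ∈ V, ract ψ.1 v ∈ N' → v ∈ N := by
        have hU : V ⊓ N'.comap (ract ψ.1) ≤ N := by
          refine (hsimple _ inf_le_left (hV.inf fun φ x hx => ?_)).resolve_right fun h => ?_
          · rw [Submodule.mem_comap, ← lact_ract]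
            exact hN'l φ _ hx
          · exact hwN' ((h.symm ▸ hw : w ∈ V ⊓ N'.comap (ract ψ.1)).2)
        exact fun v hv hv' => hU ⟨hv, hv'⟩
      refine ⟨w, (hVF hw).1, fun hwN => hwN' ?_, g, hgl, fun φ => ?_⟩
      · have : ract ψ.1 w = 0 := by
          refine (Module.forall_dual_apply_eq_zero_iff k _).1 fun χ => ?_
          rw [← dual_lact]
          exact ψ.2 _ (hN _ _ hwN)
        rw [this]; exact N'.zero_mem
      · refine hU _ (V.sub_mem (hV φ w hw) (V.smul_mem _ hw)) ?_
        have h1 := hN'l φ n hn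
        have h2 := N'.smul_mem (φ g) hn
        have h3 : n = g - ract ψ.1 w := eq_sub_of_add_eq' hwn
        rw [h3, map_sub, hgl.lact_eq] at h1
        rw [h3, smul_sub] at h2
        have h4 := N'.sub_mem h2 h1
        rw [map_sub, map_smul, ← lact_ract]
        convert h4 using 1
        abel

/-- Decomposition of a left comodule over a span of group-like elements. -/
lemma mem_span_isSkewModulo {N : Submodule k C} {h : C}
    (hh : ∀ φ : Module.Dual k C, (∀ g, IsGroupLikeElem k g → φ g = 0) → lact φ h ∈ N) :
    h ∈ Submodule.span k {w : C | w ∈ N ∨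
      (∃ φ : Module.Dual k C, w = lact φ h) ∧ IsSkewModulo N w} := by
  obtain ⟨s, b, hcoord⟩ := exists_basis_groupLike k C
  obtain ⟨t, ht⟩ := exists_eq_sum_lslice b (Coalgebra.comul (R := k) h)
  have h1 : h = ∑ i ∈ t, Coalgebra.counit (R := k) (b i) • lact (b.coord i) h := by
    conv_lhs => rw [← lact_counit (k := k) h, lact_apply, ht, map_sum]
    simp only [lslice_tmul, lact_apply]
  rw [h1]
  refine Submodule.sum_mem _ fun i _ => Submodule.smul_mem _ _ (Submodule.subset_span ?_)
  rw [← h1]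
  by_cases hi : IsGroupLikeElem k (i : C)
  · refine Or.inr ⟨⟨_, rfl⟩, i, hi, fun φ => ?_⟩
    rw [lact_lact]
    -- This functional kills every group-like `g`: its value there is `b.coord i g * (φ g - φ i)`,
    -- and the coordinate vanishes unless `g = i`.
    have h2 := hh (φ ∘ₗ lact (b.coord i) - φ i • b.coord i) fun g hg => ?_
    · have h3 : lact (φ ∘ₗ lact (b.coord i) - φ i • b.coord i) h =
        lact (φ ∘ₗ lact (b.coord i)) h - φ i • lact (b.coord i) h := by
        rw [lact_sub, lact_smul]
      rwa [h3] at h2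
    · by_cases hig : (i : C) = g
      · simp [hg.lact_eq, hig, mul_comm]
      · simp [hg.lact_eq, hcoord i g hg hig]
  · exact Or.inl (hh _ fun g hg => hcoord i g hg fun h => hi (h ▸ hg))

end Coideals

end PointedHopf

namespace PointedHopf

/-! ### The coradical filtration of a pointed coalgebra -/

section Filtration

variable {k C : Type*} [Field k] [AddCommGroup C] [Module k C] [Coalgebra k C]

lemma mem_coradicalFiltration_zero (hp : IsPointed k C) {h : C} :
    h ∈ coradicalFiltration k C 0 ↔ h ∈ Submodule.span k {g : C | IsGroupLikeElem k g} := by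
  rw [← show coradical k C = _ from hp, coradicalFiltration]

lemma mem_coradicalFiltration_succ (hp : IsPointed k C) {n : ℕ} {h : C} :
    h ∈ coradicalFiltration k C (n + 1) ↔ ∀ ψ : Module.Dual k C,
      (∀ g, IsGroupLikeElem k g → ψ g = 0) → ract ψ h ∈ coradicalFiltration k C n := by
  rw [coradicalFiltration, Submodule.mem_comap, mem_sup_tensorSub,
    show coradical k C = _ from hp]
  refine forall_congr' fun ψ => imp_congr ⟨fun H g hg => H g (Submodule.subset_span hg),
    fun H => ?_⟩ Iff.rfl
  have : Submodule.span k {g : C | IsGroupLikeElem k g} ≤ LinearMap.ker ψ :=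
    Submodule.span_le.2 H
  exact fun v hv => this hv

lemma mem_span_groupLike_of_forall_dual {h : C}
    (H : ∀ ψ : Module.Dual k C, (∀ g, IsGroupLikeElem k g → ψ g = 0) → ψ h = 0) :
    h ∈ Submodule.span k {g : C | IsGroupLikeElem k g} := by
  by_contra hh
  obtain ⟨ψ, hψ, hψ'⟩ := Submodule.exists_le_ker_of_notMem hh
  exact hψ (H ψ fun g hg => hψ' (Submodule.subset_span hg))

/-- The coradical filtration is left-right symmetric. -/
lemma mem_coradicalFiltration_succ' (hp : IsPointed k C) {n : ℕ} {h : C} :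
    h ∈ coradicalFiltration k C (n + 1) ↔ ∀ φ : Module.Dual k C,
      (∀ g, IsGroupLikeElem k g → φ g = 0) → lact φ h ∈ coradicalFiltration k C n := by
  induction n generalizing h with
  | zero =>
    simp only [mem_coradicalFiltration_succ hp, mem_coradicalFiltration_zero hp]
    -- Both conditions amount to `φ(h₁)ψ(h₂) = 0` for all `φ`, `ψ` vanishing on group-like elements.
    have hv : ∀ ψ : Module.Dual k C, (∀ g, IsGroupLikeElem k g → ψ g = 0) →
        ∀ v ∈ Submodule.span k {g : C | IsGroupLikeElem k g}, ψ v = 0 := fun ψ H v hv =>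
      (Submodule.span_le.2 H : Submodule.span k {g : C | IsGroupLikeElem k g} ≤ LinearMap.ker ψ) hv
    constructor
    · intro H φ hφ
      refine mem_span_groupLike_of_forall_dual fun ψ hψ => ?_
      rw [dual_lact]
      exact hv φ hφ _ (H ψ hψ)
    · intro H ψ hψ
      refine mem_span_groupLike_of_forall_dual fun φ hφ => ?_
      rw [← dual_lact]
      exact hv ψ hψ _ (H φ hφ)
  | succ n ih =>
    rw [mem_coradicalFiltration_succ hp]
    constructor
    · intro H φ hφ
      rw [mem_coradicalFiltration_succ hp]
      intro ψ hψ
      rw [← lact_ract]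
      exact ih.1 (H ψ hψ) φ hφ
    · intro H ψ hψ
      rw [ih]
      intro φ hφ
      rw [lact_ract]
      exact (mem_coradicalFiltration_succ hp).1 (H φ hφ) ψ hψ

lemma isLeftCoideal_coradicalFiltration (hp : IsPointed k C) (n : ℕ) :
    IsLeftCoideal (coradicalFiltration k C n) := by
  induction n with
  | zero =>
    rw [coradicalFiltration, show coradical k C = _ from hp]
    exact isLeftCoideal_span_groupLike fun g hg => hg
  | succ n ih =>
    intro φ h hh
    rw [mem_coradicalFiltration_succ hp] at hh ⊢
    intro ψ hψ
    rw [← lact_ract]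
    exact ih φ _ (hh ψ hψ)

lemma coradicalFiltration_le_succ (hp : IsPointed k C) (n : ℕ) :
    coradicalFiltration k C n ≤ coradicalFiltration k C (n + 1) := by
  induction n with
  | zero =>
    intro h hh
    rw [mem_coradicalFiltration_succ' hp]
    exact fun φ _ => isLeftCoideal_coradicalFiltration hp 0 φ h hh
  | succ n ih =>
    intro h hh
    rw [mem_coradicalFiltration_succ' hp] at hh ⊢
    exact fun φ hφ => ih (hh φ hφ)

lemma coradicalFiltration_mono (hp : IsPointed k C) : Monotone (coradicalFiltration k C) :=
  monotone_nat_of_le_succ (coradicalFiltration_le_succ hp)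

lemma groupLike_mem_coradicalFiltration (hp : IsPointed k C) {g : C} (hg : IsGroupLikeElem k g)
    (n : ℕ) : g ∈ coradicalFiltration k C n :=
  coradicalFiltration_mono hp n.zero_le
    ((mem_coradicalFiltration_zero hp).2 (Submodule.subset_span hg))

/-- The coradical filtration is exhaustive. -/
lemma exists_mem_coradicalFiltration (hp : IsPointed k C) (h : C) :
    ∃ n, h ∈ coradicalFiltration k C n := by
  have hdir := (coradicalFiltration_mono hp).directed_le
  rw [← Submodule.mem_iSup_of_directed _ hdir]
  by_contra hh
  obtain ⟨w, -, hw, g, hg, hgw⟩ := (isPointed_iff.1 hp).exists_isSkewModulo (W := ⊤)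
    (.iSup (isLeftCoideal_coradicalFiltration hp)) (fun _ _ _ => Submodule.mem_top)
    fun hle => hh (hle Submodule.mem_top)
  apply hw
  obtain ⟨F, hF, hFw⟩ := finite_lslice (k := k) (Coalgebra.comul (R := k) w)
  -- The slices of `Δ(w)` span a finite-dimensional space, so one `n` serves every `φ`. This puts
  -- `w` in term `n + 1`, a contradiction.
  obtain ⟨n, hn⟩ : ∃ n, F ⊓ ⨆ n, coradicalFiltration k C n ≤ coradicalFiltration k C n := by
    have hfg : (F ⊓ ⨆ n, coradicalFiltration k C n).FG :=
      (Submodule.fg_iff_finiteDimensional _).2 inferInstance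
    obtain ⟨s, hs⟩ := hfg
    have hs' : ∀ x ∈ s, ∃ n, x ∈ coradicalFiltration k C n := fun x hx => by
      rw [← Submodule.mem_iSup_of_directed _ hdir]
      exact (hs ▸ Submodule.subset_span hx : x ∈ F ⊓ ⨆ n, coradicalFiltration k C n).2
    choose! m hm using hs'
    refine ⟨s.sup m, ?_⟩
    rw [← hs]
    exact Submodule.span_le.2 fun x hx =>
      coradicalFiltration_mono hp (Finset.le_sup hx) (hm x hx)
  refine Submodule.mem_iSup_of_mem (n + 1) ((mem_coradicalFiltration_succ' hp).2 fun φ hφ => ?_)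
  refine hn ⟨hFw φ, ?_⟩
  simpa [hφ g hg] using hgw φ

end Filtration

/-! ### Freeness over invertible left coideal subalgebras -/

section CoidealSubalgebra

variable {k H : Type*} [Field k] [Ring H] [HopfAlgebra k H]

/-- The augmentation part of a subspace. -/
def augPart (B : Submodule k H) : Submodule k H :=
  B ⊓ LinearMap.ker (Coalgebra.counit (R := k) (A := H))

lemma mul_mem_tensorSub {B N : Submodule k H} (hBN : B * N ≤ N) {s t : H ⊗[k] H}
    (hs : s ∈ tensorSub k ⊤ B) (ht : t ∈ tensorSub k ⊤ N) : s * t ∈ tensorSub k ⊤ N := by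
  have h1 : ∀ a b : H, b ∈ B →
      tensorSub k ⊤ N ≤ (tensorSub k ⊤ N).comap (LinearMap.mulLeft k (a ⊗ₜ[k] b)) :=
    fun a b hb => tensorSub_le fun c _ d hd => by
      simpa using tmul_mem_tensorSub Submodule.mem_top (hBN (Submodule.mul_mem_mul hb hd))
  have h2 : tensorSub k ⊤ B ≤ (tensorSub k ⊤ N).comap (LinearMap.mulRight k t) :=
    tensorSub_le fun a _ b hb => by simpa using h1 a b hb ht
  exact h2 hs

lemma lslice_mul_tmul (φ : Module.Dual k H) (g h : H) (s : H ⊗[k] H) :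
    lslice φ (s * g ⊗ₜ[k] h) = lslice (φ ∘ₗ LinearMap.mulRight k g) s * h := by
  induction s with
  | zero => simp
  | tmul a b => simp
  | add s t hs ht => simp [add_mul, hs, ht]

/-- Multiplicativity of `Δ` gives `Δ(bh) ≡ Δ(b)(g ⊗ h)` modulo `H ⊗ N`. -/
lemma lact_mul_sub_mem {B N : Submodule k H} (hB : IsLeftCoideal B) (hBN : B * N ≤ N) {g h : H}
    (hgh : ∀ φ : Module.Dual k H, lact φ h - φ g • h ∈ N) {b : H} (hb : b ∈ B)
    (φ : Module.Dual k H) :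
    lact φ (b * h) - lact (φ ∘ₗ LinearMap.mulRight k g) b * h ∈ N := by
  have h1 : Coalgebra.comul (R := k) b ∈ tensorSub k ⊤ B :=
    mem_tensorSub_top_left.2 fun φ => hB φ b hb
  have h2 : Coalgebra.comul (R := k) h - g ⊗ₜ[k] h ∈ tensorSub k ⊤ N :=
    mem_tensorSub_top_left.2 fun φ => by rw [map_sub, lslice_tmul]; exact hgh φ
  have h3 := mem_tensorSub_top_left.1 (mul_mem_tensorSub hBN h1 h2) φ
  rwa [mul_sub, map_sub, lslice_mul_tmul, ← Bialgebra.comul_mul] at h3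

variable (k) in
/-- Left coideal subalgebras whose group-like elements are invertible in the subalgebra. -/
structure IsInvertibleCoidealSubalgebra (B : Subalgebra k H) : Prop where
  isLeftCoideal : IsLeftCoideal (Subalgebra.toSubmodule B)
  antipode_mem : ∀ g ∈ B, IsGroupLikeElem k g → HopfAlgebra.antipode k g ∈ B

variable {B : Subalgebra k H} {N M : Submodule k H} {h : H}

/-- Left multiplication on a skew element modulo `N` is injective modulo `N`. -/
lemma eq_zero_of_mul_mem (hH : SubcoalgebrasHaveGroupLike k H)
    (hB : IsInvertibleCoidealSubalgebra k B)
    (hN : IsLeftCoideal N) (hBN : Subalgebra.toSubmodule B * N ≤ N) (hh : IsSkewModulo N h)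
    (hhN : h ∉ N) {b : H} (hb : b ∈ B) (hbh : b * h ∈ N) : b = 0 := by
  obtain ⟨g, hg, hgh⟩ := hh
  -- The annihilator of `h` modulo `N` is a left coideal: twisting functionals by `S(g)` cancels the
  -- factor `g`. If nonzero, it contains a group-like element, whose inverse lies in `B`, and that
  -- forces `h ∈ N`.
  set L : Submodule k H := Subalgebra.toSubmodule B ⊓ N.comap (LinearMap.mulRight k h) with hL
  have hLc : IsLeftCoideal L := by
    rintro φ c ⟨hc, hch⟩
    refine ⟨hB.isLeftCoideal φ c hc, ?_⟩
    have h1 := lact_mul_sub_mem hB.isLeftCoideal hBN hgh hc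
      (φ ∘ₗ LinearMap.mulRight k (HopfAlgebra.antipode k g))
    have h2 : (φ ∘ₗ LinearMap.mulRight k (HopfAlgebra.antipode k g)) ∘ₗ
        LinearMap.mulRight k g = φ := by
      ext x
      simp [mul_assoc, hg.mul_antipode_cancel]
    rw [h2] at h1
    have h3 := N.sub_mem (hN (φ ∘ₗ LinearMap.mulRight k (HopfAlgebra.antipode k g)) _ hch) h1
    rwa [LinearMap.mulRight_apply, sub_sub_cancel] at h3
  by_contra hb0
  obtain ⟨w, hwL, hw0, g', hg', hgw⟩ := hH.exists_isSkewModulo (N := ⊥) (W := L)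
    (fun φ x hx => by simp [(Submodule.mem_bot k).1 hx]) hLc
    fun hle => hb0 ((Submodule.mem_bot k).1 (hle ⟨hb, hbh⟩))
  -- Skew modulo zero means `Δ(w) = g' ⊗ w`; apply `id ⊗ ε`.
  have hw : w = Coalgebra.counit (R := k) w • g' := by
    refine sub_eq_zero.1 ((Module.forall_dual_apply_eq_zero_iff k _).1 fun φ => ?_)
    have h1 := congrArg (Coalgebra.counit (R := k)) ((Submodule.mem_bot k).1 (hgw φ))
    rw [map_sub, counit_lact, map_smul, map_zero] at h1
    rw [map_sub, map_smul, ← h1, smul_eq_mul, smul_eq_mul, mul_comm]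
  have hw1 : Coalgebra.counit (R := k) w ≠ 0 := fun h0 => hw0 (by rw [hw, h0]; simp)
  have hg'L : g' ∈ L := by
    rw [hw] at hwL
    exact (Submodule.smul_mem_iff _ hw1).1 hwL
  have := hBN (Submodule.mul_mem_mul (hB.antipode_mem g' hg'L.1 hg') hg'L.2)
  rw [LinearMap.mulRight_apply, ← mul_assoc, hg'.antipode_mul_cancel, one_mul] at this
  exact hhN this

/-- Adjoining a skew element to a coideal submodule. -/
lemma isLeftCoideal_sup_mul (hB : IsLeftCoideal (Subalgebra.toSubmodule B))
    (hN : IsLeftCoideal N) (hBN : Subalgebra.toSubmodule B * N ≤ N) (hh : IsSkewModulo N h) :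
    IsLeftCoideal (N ⊔ Subalgebra.toSubmodule B * Submodule.span k {h}) := by
  obtain ⟨g, hg, hgh⟩ := hh
  intro φ x hx
  obtain ⟨n, hn, y, hy, rfl⟩ := Submodule.mem_sup.1 hx
  obtain ⟨b, hb, rfl⟩ := Submodule.mem_mul_span_singleton.1 hy
  rw [map_add]
  refine Submodule.add_mem _ (Submodule.mem_sup_left (hN φ n hn)) ?_
  have h1 := lact_mul_sub_mem hB hBN hgh hb φ
  have h2 : lact (φ ∘ₗ LinearMap.mulRight k g) b * h ∈
      Subalgebra.toSubmodule B * Submodule.span k {h} :=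
    Submodule.mul_mem_mul (hB _ b hb) (Submodule.mem_span_singleton_self h)
  rw [← sub_add_cancel (lact φ (b * h)) (lact (φ ∘ₗ LinearMap.mulRight k g) b * h)]
  exact Submodule.add_mem_sup h1 h2

lemma mul_sup_mul_le (hBN : Subalgebra.toSubmodule B * N ≤ N) (P : Submodule k H) :
    Subalgebra.toSubmodule B * (N ⊔ Subalgebra.toSubmodule B * P) ≤
      N ⊔ Subalgebra.toSubmodule B * P := by
  rw [Submodule.mul_sup, ← mul_assoc, B.isIdempotentElem_toSubmodule.eq]
  exact sup_le_sup_right hBN _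

/-- `B⁺H ∩ M = B⁺M` for every coideal `B`-submodule `M`. -/
lemma augPart_mul_top_inf_le (hH : SubcoalgebrasHaveGroupLike k H)
    (hB : IsInvertibleCoidealSubalgebra k B)
    (hM : IsLeftCoideal M) (hBM : Subalgebra.toSubmodule B * M ≤ M) :
    augPart (Subalgebra.toSubmodule B) * ⊤ ⊓ M ≤ augPart (Subalgebra.toSubmodule B) * M := by
  set A := augPart (Subalgebra.toSubmodule B) with hA
  -- Zorn's lemma on the intermediate `N` with `B⁺N ∩ M ⊆ B⁺M`. If `N ≠ H`, a skew `h` can be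
  -- adjoined: an element `n + bh` of `M` has `bh ∈ N`, so `b = 0` by freeness.
  obtain ⟨N, hMN, ⟨hN, hBN, hle⟩, hmax⟩ : ∃ N, M ≤ N ∧ Maximal (fun N => IsLeftCoideal N ∧
      Subalgebra.toSubmodule B * N ≤ N ∧ A * N ⊓ M ≤ A * M) N := by
    refine zorn_le_nonempty₀ {N | IsLeftCoideal N ∧
      Subalgebra.toSubmodule B * N ≤ N ∧ A * N ⊓ M ≤ A * M} ?_ M ⟨hM, hBM, inf_le_left⟩
    intro c hc hchain y hy
    have hdir : DirectedOn (· ≤ ·) c := hchain.directedOn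
    have hne : c.Nonempty := ⟨y, hy⟩
    refine ⟨sSup c, ⟨?_, ?_, ?_⟩, fun z hz => le_sSup hz⟩
    · rw [sSup_eq_iSup']
      exact .iSup fun N => (hc N.2).1
    · rw [Submodule.mul_le]
      intro b hb x hx
      obtain ⟨N, hN, hx⟩ := (Submodule.mem_sSup_of_directed hne hdir).1 hx
      exact (le_sSup hN : N ≤ sSup c) ((hc hN).2.1 (Submodule.mul_mem_mul hb hx))
    · have h1 : A * sSup c = ⨆ N : c, A * (N : Submodule k H) := by
        rw [sSup_eq_iSup', Submodule.mul_iSup]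
      have hd : Directed (· ≤ ·) fun N : c => A * (N : Submodule k H) := by
        intro N N'
        obtain ⟨P, hP, h1, h2⟩ := hdir N.1 N.2 N'.1 N'.2
        exact ⟨⟨P, hP⟩, mul_le_mul' le_rfl h1, mul_le_mul' le_rfl h2⟩
      have : Nonempty c := ⟨⟨y, hy⟩⟩
      rw [h1]
      rintro x ⟨hx, hxM⟩
      obtain ⟨N, hx⟩ := (Submodule.mem_iSup_of_directed _ hd).1 hx
      exact (hc N.2).2.2 ⟨hx, hxM⟩
  by_cases htop : N = ⊤
  · rwa [htop] at hle
  exfalso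
  obtain ⟨h, -, hhN, hh⟩ := hH.exists_isSkewModulo (W := ⊤) hN (fun _ _ _ => Submodule.mem_top)
    fun hle => htop (top_le_iff.1 hle)
  have hN' := hmax (y := N ⊔ Subalgebra.toSubmodule B * Submodule.span k {h})
    ⟨isLeftCoideal_sup_mul hB.isLeftCoideal hN hBN hh, mul_sup_mul_le hBN _, ?_⟩ le_sup_left
  · refine hhN (hN' (Submodule.mem_sup_right ?_))
    simpa using Submodule.mul_mem_mul (show (1 : H) ∈ Subalgebra.toSubmodule B from B.one_mem)
      (Submodule.mem_span_singleton_self (R := k) h)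
  · rintro x ⟨hx, hxM⟩
    refine hle ⟨?_, hxM⟩
    rw [Submodule.mul_sup, ← mul_assoc] at hx
    obtain ⟨n, hn, y, hy, rfl⟩ := Submodule.mem_sup.1 hx
    obtain ⟨b, hb, rfl⟩ := Submodule.mem_mul_span_singleton.1 hy
    have hb' : b ∈ B := by
      have : A * Subalgebra.toSubmodule B ≤ Subalgebra.toSubmodule B :=
        (mul_le_mul' inf_le_left le_rfl).trans_eq B.isIdempotentElem_toSubmodule.eq
      exact this hb
    have hnN : n ∈ N := hBN ((mul_le_mul' inf_le_left le_rfl : _ ≤ Subalgebra.toSubmodule B * N) hn)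
    have hbh : b * h ∈ N := by simpa using N.sub_mem (hMN hxM) hnN
    rw [eq_zero_of_mul_mem hH hB hN hBN hh hhN hb' hbh]
    simpa using hn

/-- A skew element modulo `N` that lies in `N + B⁺H` lies in `N`. -/
lemma mem_of_isSkewModulo (hH : SubcoalgebrasHaveGroupLike k H)
    (hB : IsInvertibleCoidealSubalgebra k B)
    (hN : IsLeftCoideal N) (hBN : Subalgebra.toSubmodule B * N ≤ N) (hh : IsSkewModulo N h)
    (hmem : h ∈ N ⊔ augPart (Subalgebra.toSubmodule B) * ⊤) : h ∈ N := by
  by_contra hhN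
  obtain ⟨n, hn, z, hz, hnz⟩ := Submodule.mem_sup.1 hmem
  have hhM : h ∈ N ⊔ Subalgebra.toSubmodule B * Submodule.span k {h} :=
    Submodule.mem_sup_right <| by
      simpa using Submodule.mul_mem_mul (show (1 : H) ∈ Subalgebra.toSubmodule B from B.one_mem)
        (Submodule.mem_span_singleton_self (R := k) h)
  have hzM : z ∈ N ⊔ Subalgebra.toSubmodule B * Submodule.span k {h} := by
    rw [← eq_sub_of_add_eq' hnz |>.symm]
    exact Submodule.sub_mem _ hhM (Submodule.mem_sup_left hn)
  have h1 := augPart_mul_top_inf_le hH hB (isLeftCoideal_sup_mul hB.isLeftCoideal hN hBN hh)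
    (mul_sup_mul_le hBN _) ⟨hz, hzM⟩
  rw [Submodule.mul_sup, ← mul_assoc] at h1
  obtain ⟨m, hm, y, hy, rfl⟩ := Submodule.mem_sup.1 h1
  obtain ⟨b, hb, rfl⟩ := Submodule.mem_mul_span_singleton.1 hy
  have hb' : b ∈ B ∧ Coalgebra.counit (R := k) b = 0 := by
    have : augPart (Subalgebra.toSubmodule B) * Subalgebra.toSubmodule B ≤
        augPart (Subalgebra.toSubmodule B) := by
      rw [Submodule.mul_le]
      rintro c ⟨hc, hc'⟩ d hd
      rw [SetLike.mem_coe, LinearMap.mem_ker] at hc'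
      exact ⟨B.mul_mem hc hd, by simp [hc']⟩
    exact this hb
  have hmN : m ∈ N := hBN ((mul_le_mul' inf_le_left le_rfl : _ ≤ Subalgebra.toSubmodule B * N) hm)
  -- Intersecting with `M = N + Bh` gave `h = n + m + bh` with `b ∈ B⁺`. Since `ε(1 - b) = 1`,
  -- freeness is contradicted.
  have h2 : (1 - b) * h ∈ N := by
    have : (1 - b) * h = n + m := by
      rw [sub_mul, one_mul, sub_eq_iff_eq_add, add_assoc, hnz]
    rw [this]
    exact N.add_mem hn hmN
  have h3 := eq_zero_of_mul_mem hH hB hN hBN hh hhN (B.sub_mem B.one_mem hb'.1) h2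
  have h4 := congrArg (Coalgebra.counit (R := k)) h3
  simp [hb'.2] at h4

end CoidealSubalgebra

end PointedHopf

namespace PointedHopf

/-! ### Evaluating relations, and independence of group-like elements -/

section Words

variable {k H X : Type*} [Field k] [Ring H] [Algebra k H]

lemma lift_eq_sum (f : X → H) (p : FreeAlgebra k X) :
    FreeAlgebra.lift k f p =
      (FreeAlgebra.equivMonoidAlgebraFreeMonoid p).coeff.sum
        fun w c => c • (w.toList.map f).prod := by
  have h : FreeAlgebra.lift k f = (MonoidAlgebra.lift k H (FreeMonoid X) (FreeMonoid.lift f)).comp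
      FreeAlgebra.equivMonoidAlgebraFreeMonoid.toAlgHom := by
    ext x
    simp [FreeAlgebra.equivMonoidAlgebraFreeMonoid]
  rw [h]
  simp [MonoidAlgebra.lift_apply, FreeMonoid.lift_apply]

/-- If every other word of a relation evaluates into `P`, then so does the distinguished word. -/
lemma prod_mem_of_lift_eq_zero (f : X → H) {p : FreeAlgebra k X}
    (hp : FreeAlgebra.lift k f p = 0) {w : List X} (hw : wordCoeff p w ≠ 0) {P : Submodule k H}
    (hP : ∀ v, wordCoeff p v ≠ 0 → v ≠ w → (v.map f).prod ∈ P) : (w.map f).prod ∈ P := by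
  classical
  rw [lift_eq_sum, Finsupp.sum,
    ← Finset.add_sum_erase _ _ (Finsupp.mem_support_iff.2 hw)] at hp
  refine (Submodule.smul_mem_iff P hw).1 ?_
  have h := eq_neg_of_add_eq_zero_left hp
  rw [FreeMonoid.toList_ofList] at h
  unfold wordCoeff
  rw [h]
  refine P.neg_mem (P.sum_mem fun v hv => P.smul_mem _ ?_)
  rw [Finset.mem_erase, Finsupp.mem_support_iff] at hv
  exact hP v.toList hv.2 fun h => hv.1 (by rw [← h]; rfl)

end Words

lemma mem_of_groupLike_mem_span {k C : Type*} [Field k] [AddCommGroup C] [Module k C]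
    [Coalgebra k C] {s : Set C} (hs : ∀ g ∈ s, IsGroupLikeElem k g) {g : C}
    (hg : IsGroupLikeElem k g) (hgs : g ∈ Submodule.span k s) : g ∈ s := by
  by_contra h
  have hli := linearIndep_groupLikeVal (R := k) (A := C)
  refine hli.notMem_span_image (s := {x : GroupLike k C | x.val ∈ s}) (x := ⟨g, hg⟩) h ?_
  have : GroupLike.val '' {x : GroupLike k C | x.val ∈ s} = s :=
    Set.ext fun x => ⟨fun ⟨y, hy, hyx⟩ => hyx ▸ hy, fun hx => ⟨⟨x, hs x hx⟩, hx, rfl⟩⟩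
  rwa [this]

/-! ### Consequences of an adapted generating set -/

section Generators

variable {k H : Type*} [Field k] [Ring H] [HopfAlgebra k H]
  {O : Type*} [LinearOrder O] {D : Set O} {f : Letter D → H} {t : Letter D → ℕ}

variable (k f) in
/-- The subalgebra generated by the letters with smaller original element. -/
def lowerSubalgebra (a : O) : Subalgebra k H := Algebra.adjoin k (f '' {y | orig y < a})

variable (k f) in
/-- The left module over the lower subalgebra generated by `1` and, below a mirror letter,
by the original letter. -/
def lowerSubmodule : Letter D → Submodule k H
  | Sum.inl a => Subalgebra.toSubmodule (lowerSubalgebra k f a)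
  | Sum.inr d => Subalgebra.toSubmodule (lowerSubalgebra k f (d : O)) ⊔
      Subalgebra.toSubmodule (lowerSubalgebra k f (d : O)) * Submodule.span k {f (Sum.inl (d : O))}

lemma mem_lowerSubalgebra {y : Letter D} {a : O} (h : orig y < a) : f y ∈ lowerSubalgebra k f a :=
  Algebra.subset_adjoin ⟨y, h, rfl⟩

lemma lowerSubalgebra_le_lowerSubmodule (x : Letter D) :
    Subalgebra.toSubmodule (lowerSubalgebra k f (orig x)) ≤ lowerSubmodule k f x := by
  cases x with
  | inl a => exact le_rfl
  | inr d => exact le_sup_left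

lemma map_antipode_one_sub {g : H} :
    HopfAlgebra.antipode k (1 - g) = 1 - HopfAlgebra.antipode k g := by
  rw [map_sub, HopfAlgebra.antipode_one]

lemma antipode_eq_pow {g : H} (hg : IsGroupLikeElem k g) {n : ℕ} (hn : g ^ (n + 1) = 1) :
    HopfAlgebra.antipode k g = g ^ n := by
  rw [← mul_one (HopfAlgebra.antipode k g), ← hn, pow_succ', ← mul_assoc,
    hg.antipode_mul_cancel, one_mul]

lemma mul_lowerSubmodule_le (x : Letter D) :
    Subalgebra.toSubmodule (lowerSubalgebra k f (orig x)) * lowerSubmodule k f x ≤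
      lowerSubmodule k f x := by
  rcases x with a | d
  · exact (Subalgebra.isIdempotentElem_toSubmodule _).le
  · exact mul_sup_mul_le (Subalgebra.isIdempotentElem_toSubmodule _).le _

namespace IsAdaptedGeneratingSet

lemma degree_eq_zero (hf : IsAdaptedGeneratingSet k f t)
    {x : Letter D} (hx : orig x ∈ D) : t x = 0 := by
  have h1 : f x ∈ f '' {x | orig x ∈ D} := ⟨x, hx, rfl⟩
  rw [hf.image_infinite_order] at h1
  obtain ⟨g, hg, -, hxg⟩ := h1
  have h2 : f x ∈ f '' {x | t x = 0} := by
    rw [hf.image_degree_zero]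
    exact ⟨g, hg, hxg⟩
  obtain ⟨y, hy, hyx⟩ := h2
  rwa [← hf.injective hyx]

/-- A letter and its mirror both have degree `0`, so a strict comparison of degrees cannot occur
within such a pair. -/
lemma orig_lt (hf : IsAdaptedGeneratingSet k f t)
    {x y : Letter D} (h : t x < t y) : orig x < orig y := by
  rcases hf.lt_of_degree_lt x y h with h1 | ⟨-, -, h2⟩
  · exact h1
  · obtain ⟨d, rfl⟩ := Sum.isRight_iff.1 h2
    rw [hf.degree_eq_zero (x := Sum.inr d) d.2] at h
    exact absurd h (Nat.not_lt_zero _)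

lemma exists_eq_one_sub (hf : IsAdaptedGeneratingSet k f t) {x : Letter D} (hx : t x = 0) :
    ∃ g, IsGroupLikeElem k g ∧ f x = 1 - g := by
  have : f x ∈ f '' {x | t x = 0} := ⟨x, hx, rfl⟩
  rwa [hf.image_degree_zero] at this

lemma exists_letter (hf : IsAdaptedGeneratingSet k f t)
    {g : H} (hg : IsGroupLikeElem k g) : ∃ x, t x = 0 ∧ f x = 1 - g := by
  have : 1 - g ∈ f '' {x | t x = 0} := by
    rw [hf.image_degree_zero]
    exact ⟨g, hg, rfl⟩
  exact this

/-- The term `f(x) ⊗ 1` of the coproduct is absorbed because `1 ∈ N`. -/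
lemma isSkewModulo (hf : IsAdaptedGeneratingSet k f t)
    {x : Letter D} {N : Submodule k H} (h1 : 1 ∈ N)
    (hN : ∀ y, t y < t x → f y ∈ N) : IsSkewModulo N (f x) := by
  obtain ⟨g, hg, h⟩ := hf.comul x
  refine ⟨g, hg, fun φ => ?_⟩
  have h2 := mem_tensorSub_top_left.1 (mem_tensorSub.1 h).2 φ
  rw [map_sub, map_sub, lslice_tmul, lslice_tmul, ← lact_apply] at h2
  have h3 : Submodule.span k (f '' {y | t y < t x}) ≤ N := by
    rw [Submodule.span_le]
    rintro _ ⟨y, hy, rfl⟩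
    exact hN y hy
  have h4 := N.add_mem (h3 h2) (N.smul_mem (φ (f x)) h1)
  convert h4 using 1
  abel

lemma isLeftCoideal_lowerSubalgebra (hf : IsAdaptedGeneratingSet k f t) (a : O) :
    IsLeftCoideal (Subalgebra.toSubmodule (lowerSubalgebra k f a)) := by
  set B := lowerSubalgebra k f a with hB
  suffices h : ∀ x ∈ B, Coalgebra.comul (R := k) x ∈ tensorSub k ⊤ (Subalgebra.toSubmodule B) from
    fun φ x hx => mem_tensorSub_top_left.1 (h x hx) φ
  intro x hx
  induction hx using Algebra.adjoin_induction with
  | mem x hx =>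
    obtain ⟨y, hy, rfl⟩ := hx
    obtain ⟨g, -, hg⟩ := hf.isSkewModulo (x := y) (N := Subalgebra.toSubmodule B) B.one_mem
      fun z hz => mem_lowerSubalgebra ((hf.orig_lt hz).trans hy)
    refine mem_tensorSub_top_left.2 fun φ => ?_
    have := Submodule.add_mem _ (hg φ) (Submodule.smul_mem _ (φ g)
      (show f y ∈ Subalgebra.toSubmodule B from mem_lowerSubalgebra hy))
    rwa [sub_add_cancel] at this
  | algebraMap r =>
    rw [Bialgebra.comul_algebraMap, Algebra.TensorProduct.algebraMap_apply']
    exact tmul_mem_tensorSub Submodule.mem_top (B.algebraMap_mem r)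
  | add x y _ _ hx hy => rw [map_add]; exact Submodule.add_mem _ hx hy
  | mul x y _ _ hx hy =>
    rw [Bialgebra.comul_mul]
    exact mul_mem_tensorSub B.isIdempotentElem_toSubmodule.le hx hy

/-- If `1 - g` is a letter of infinite order, then `1 - g⁻¹` is its mirror letter. -/
lemma exists_mirror (hf : IsAdaptedGeneratingSet k f t)
    {x : Letter D} {g : H} (hg : IsGroupLikeElem k g) (hxg : f x = 1 - g)
    (hfin : ¬ IsOfFinOrder g) : ∃ y, orig y = orig x ∧ f y = 1 - HopfAlgebra.antipode k g := by
  have h1 : f x ∈ f '' {x | orig x ∈ D} := by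
    rw [hf.image_infinite_order]
    exact ⟨g, hg, hfin, hxg⟩
  obtain ⟨x', hx', hxx'⟩ := h1
  obtain rfl := hf.injective hxx'
  rcases x' with a | d
  · exact ⟨Sum.inr ⟨a, hx'⟩, rfl, by rw [hf.mirror, hxg, map_antipode_one_sub]⟩
  · have h2 : f (Sum.inl (d : O)) ∈ f '' {x | orig x ∈ D} := ⟨_, d.2, rfl⟩
    rw [hf.image_infinite_order] at h2
    obtain ⟨g', hg', -, hdg'⟩ := h2
    refine ⟨Sum.inl d, rfl, ?_⟩
    rw [hf.mirror, hdg', map_antipode_one_sub] at hxg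
    rw [hdg', ← sub_right_injective hxg, hg'.antipode_antipode]

/-- If some lower letter has positive degree, all letters `1 - g` are lower. Otherwise `B` is
spanned by a monoid of group-like elements with inverses in `B`: an inverse is a power when the
order is finite and comes from the mirror letter when it is infinite. Independence of group-like
elements leaves no others in `B`. -/
lemma isInvertibleCoidealSubalgebra_lowerSubalgebra (hf : IsAdaptedGeneratingSet k f t)
    (a : O) : IsInvertibleCoidealSubalgebra k (lowerSubalgebra k f a) := by
  refine ⟨hf.isLeftCoideal_lowerSubalgebra a, fun g hgB hg => ?_⟩
  set B := lowerSubalgebra k f a with hB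
  by_cases hpos : ∃ y, orig y < a ∧ t y ≠ 0
  · obtain ⟨y, hya, hy⟩ := hpos
    obtain ⟨z, hz, hzg⟩ := hf.exists_letter hg.antipode
    have h1 : f z ∈ B := mem_lowerSubalgebra
      ((hf.orig_lt (hz ▸ Nat.pos_of_ne_zero hy : t z < t y)).trans hya)
    rw [hzg] at h1
    simpa using B.sub_mem B.one_mem h1
  · push Not at hpos
    let K : Submonoid H :=
      { carrier := {g | g ∈ B ∧ IsGroupLikeElem k g ∧ HopfAlgebra.antipode k g ∈ B}
        one_mem' := ⟨B.one_mem, .one, by rw [HopfAlgebra.antipode_one]; exact B.one_mem⟩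
        mul_mem' := by
          rintro x y ⟨hx, hxg, hx'⟩ ⟨hy, hyg, hy'⟩
          refine ⟨B.mul_mem hx hy, hxg.mul hyg, ?_⟩
          rw [HopfAlgebra.antipode_mul_antidistrib]
          exact B.mul_mem hy' hx' }
    have hle : B ≤ Algebra.adjoin k (K : Set H) := by
      rw [hB, lowerSubalgebra]
      refine Algebra.adjoin_le ?_
      rintro _ ⟨y, hya, rfl⟩
      obtain ⟨g, hg, hyg⟩ := hf.exists_eq_one_sub (hpos y hya)
      have hgB : g ∈ B := by
        have h1 : f y ∈ B := mem_lowerSubalgebra hya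
        rw [hyg] at h1
        simpa using B.sub_mem B.one_mem h1
      rw [hyg]
      refine sub_mem (one_mem _) (Algebra.subset_adjoin ⟨hgB, hg, ?_⟩)
      by_cases hfin : IsOfFinOrder g
      · obtain ⟨n, hn, hgn⟩ := isOfFinOrder_iff_pow_eq_one.1 hfin
        obtain ⟨m, rfl⟩ := Nat.exists_eq_succ_of_ne_zero hn.ne'
        rw [antipode_eq_pow hg hgn]
        exact B.pow_mem hgB m
      · obtain ⟨z, hz, hzg⟩ := hf.exists_mirror hg hyg hfin
        have h1 : f z ∈ B := mem_lowerSubalgebra (hz.trans_lt hya)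
        rw [hzg] at h1
        simpa using B.sub_mem B.one_mem h1
    have h1 : g ∈ Submodule.span k (K : Set H) := by
      have := hle hgB
      rw [← Subalgebra.mem_toSubmodule, Algebra.adjoin_eq_span, Submonoid.closure_eq] at this
      exact this
    exact (mem_of_groupLike_mem_span (fun x (hx : x ∈ K) => hx.2.1) hg h1).2.2

lemma isSkewModulo_lowerSubmodule (hf : IsAdaptedGeneratingSet k f t)
    (x : Letter D) : IsSkewModulo (lowerSubmodule k f x) (f x) :=
  hf.isSkewModulo (lowerSubalgebra_le_lowerSubmodule x (Subalgebra.one_mem _))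
    fun _ hy => lowerSubalgebra_le_lowerSubmodule x (mem_lowerSubalgebra (hf.orig_lt hy))

lemma isLeftCoideal_lowerSubmodule (hf : IsAdaptedGeneratingSet k f t)
    (x : Letter D) : IsLeftCoideal (lowerSubmodule k f x) := by
  rcases x with a | d
  · exact hf.isLeftCoideal_lowerSubalgebra a
  · exact isLeftCoideal_sup_mul (hf.isLeftCoideal_lowerSubalgebra d)
      (hf.isLeftCoideal_lowerSubalgebra d) (Subalgebra.isIdempotentElem_toSubmodule _).le
      (hf.isSkewModulo_lowerSubmodule (Sum.inl (d : O)))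

/-- A letter that lies in the right ideal generated by the smaller letters, up to the lower
submodule, already lies in the lower submodule. -/
lemma mem_lowerSubmodule (hf : IsAdaptedGeneratingSet k f t)
    (hH : SubcoalgebrasHaveGroupLike k H) {x : Letter D}
    (hx : f x ∈ lowerSubmodule k f x ⊔
      augPart (Subalgebra.toSubmodule (lowerSubalgebra k f (orig x))) * ⊤) :
    f x ∈ lowerSubmodule k f x :=
  mem_of_isSkewModulo hH (hf.isInvertibleCoidealSubalgebra_lowerSubalgebra _)
    (hf.isLeftCoideal_lowerSubmodule x)
    (mul_lowerSubmodule_le x) (hf.isSkewModulo_lowerSubmodule x) hx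

lemma mem_augPart (hf : IsAdaptedGeneratingSet k f t) {y : Letter D} {a : O} (h : orig y < a) :
    f y ∈ augPart (Subalgebra.toSubmodule (lowerSubalgebra k f a)) :=
  ⟨mem_lowerSubalgebra h, hf.counit_eq_zero y⟩

/-- The order compares first letters before lengths, so a long word below `x` must start with a
letter of `B⁺`. The remaining cases are the empty word and, for `x = d*`, the single letter `d`. -/
lemma prod_mem_of_redLT (hf : IsAdaptedGeneratingSet k f t)
    {x : Letter D} {v : List (Letter D)} (hv : RedLT v [x]) :
    (v.map f).prod ∈ lowerSubmodule k f x ⊔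
      augPart (Subalgebra.toSubmodule (lowerSubalgebra k f (orig x))) * ⊤ := by
  rcases v with _ | ⟨a, u⟩
  · exact Submodule.mem_sup_left (lowerSubalgebra_le_lowerSubmodule x (Subalgebra.one_mem _))
  rw [List.map_cons, List.prod_cons]
  rcases hv with hlt | ⟨heq, hlt | ⟨hlen, hlex⟩⟩
  · exact Submodule.mem_sup_right (Submodule.mul_mem_mul (hf.mem_augPart hlt) Submodule.mem_top)
  · exact absurd hlt (Nat.not_lt_zero _)
  · obtain rfl := List.length_eq_zero_iff.1 hlen
    have hax : LetterLT a x := by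
      cases hlex with
      | rel h => exact h
      | cons h => cases h
    rcases hax with hlt | ⟨-, hl, hr⟩
    · exact absurd heq hlt.ne
    · obtain ⟨d, rfl⟩ := Sum.isRight_iff.1 hr
      obtain ⟨b, rfl⟩ := Sum.isLeft_iff.1 hl
      obtain rfl : b = d := heq
      refine Submodule.mem_sup_left (Submodule.mem_sup_right ?_)
      simpa using Submodule.mul_mem_mul
        (show (1 : H) ∈ Subalgebra.toSubmodule (lowerSubalgebra k f (d : O)) from Subalgebra.one_mem _)
        (Submodule.mem_span_singleton_self (R := k) (f (Sum.inl (d : O))))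

lemma mem_lowerSubmodule_of_isReducible (hf : IsAdaptedGeneratingSet k f t)
    (hH : SubcoalgebrasHaveGroupLike k H) {x : Letter D}
    (hx : IsReducible (RingHom.ker (FreeAlgebra.lift k f)) [x]) : f x ∈ lowerSubmodule k f x := by
  obtain ⟨p, hp, hpx, hlt⟩ := hx
  refine hf.mem_lowerSubmodule hH ?_
  simpa using prod_mem_of_lift_eq_zero f ((RingHom.mem_ker).1 hp) hpx
    fun v hv hvx => hf.prod_mem_of_redLT (hlt v hv hvx)

/-- The irreducible letters generate. -/
lemma adjoin_irreducibleLetters (hf : IsAdaptedGeneratingSet k f t)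
    [WellFoundedLT O] (hH : SubcoalgebrasHaveGroupLike k H) :
    Algebra.adjoin k ((fun x => FreeAlgebra.lift k f (FreeAlgebra.ι k x)) ''
      irreducibleLetters (RingHom.ker (FreeAlgebra.lift k f))) = ⊤ := by
  simp only [FreeAlgebra.lift_ι_apply]
  set A := Algebra.adjoin k (f '' irreducibleLetters (RingHom.ker (FreeAlgebra.lift k f))) with hA
  have hirr : ∀ x, (f x ∈ lowerSubmodule k f x → f x ∈ A) → f x ∈ A := fun x hx => by
    by_cases h : IsReducible (RingHom.ker (FreeAlgebra.lift k f)) [x]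
    · exact hx (hf.mem_lowerSubmodule_of_isReducible hH h)
    · exact Algebra.subset_adjoin ⟨x, h, rfl⟩
  have key : ∀ a : O, ∀ x : Letter D, orig x = a → f x ∈ A := by
    intro a
    induction a using WellFoundedLT.induction with
    | ind a ih =>
      have hle : lowerSubalgebra k f a ≤ A := by
        refine Algebra.adjoin_le ?_
        rintro _ ⟨y, hy, rfl⟩
        exact ih _ hy y rfl
      -- The original letter comes first, since the lower submodule of its mirror involves it.
      have hinl : f (Sum.inl a) ∈ A := hirr _ fun h => hle h
      rintro (b | d) rfl
      · exact hinl
      · refine hirr _ fun h => ?_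
        have h2 : lowerSubmodule k f (Sum.inr d) ≤ Subalgebra.toSubmodule A := by
          refine sup_le hle (Submodule.mul_le.2 fun b hb c hc => A.mul_mem (hle hb) ?_)
          obtain ⟨r, rfl⟩ := Submodule.mem_span_singleton.1 hc
          exact A.smul_mem hinl r
        exact h2 h
  rw [← top_le_iff, ← hf.adjoin_range]
  refine Algebra.adjoin_le ?_
  rintro _ ⟨x, rfl⟩
  exact key _ x rfl

lemma finiteType_of_isNoetherianRing_mulOpposite (hf : IsAdaptedGeneratingSet k f t)
    [WellFoundedLT O]
    (hH : SubcoalgebrasHaveGroupLike k H) [IsNoetherianRing Hᵐᵒᵖ] : Algebra.FiniteType k H := by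
  -- Left ideals of the opposite ring are right ideals of `H`. `J` is strictly increasing on `P`, so
  -- the Noetherian condition and the well-order together make `P` finite.
  let J : O → Ideal Hᵐᵒᵖ := fun a => Ideal.span ((fun y => MulOpposite.op (f y)) '' {y | orig y < a})
  let P : Set O := {a | MulOpposite.op (f (Sum.inl a)) ∉ J a}
  have hJ : ∀ a b, a < b → MulOpposite.op (f (Sum.inl a)) ∈ J b := fun a b hab =>
    Ideal.subset_span ⟨Sum.inl a, hab, rfl⟩
  have hJP : StrictMono fun a : P => J a := by
    intro a b hab
    refine lt_of_le_of_ne (Ideal.span_mono (Set.image_mono fun y hy => lt_trans hy hab)) fun h => ?_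
    exact a.2 ((show J a = J b from h) ▸ hJ a b hab)
  have : WellFoundedGT P := hJP.wellFoundedGT
  have : Finite P := Finite.of_wellFoundedLT_wellFoundedGT P
  have hfin : (f '' {x | orig x ∈ P}).Finite := by
    refine Set.Finite.image _ (((Set.toFinite P).image Sum.inl |>.union
      (((Set.toFinite P).preimage Subtype.val_injective.injOn).image Sum.inr)).subset ?_)
    rintro (a | d) hx
    · exact Or.inl ⟨a, hx, rfl⟩
    · exact Or.inr ⟨d, hx, rfl⟩
  set A := Algebra.adjoin k (f '' {x | orig x ∈ P}) with hA
  have key : ∀ a : O, ∀ x : Letter D, orig x = a → f x ∈ A := by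
    intro a
    induction a using WellFoundedLT.induction with
    | ind a ih =>
      set B := lowerSubalgebra k f a with hB
      have hle : B ≤ A := by
        refine Algebra.adjoin_le ?_
        rintro _ ⟨y, hy, rfl⟩
        exact ih _ hy y rfl
      intro x hxa
      by_cases haP : a ∈ P
      · exact Algebra.subset_adjoin ⟨x, show orig x ∈ P from hxa.symm ▸ haP, rfl⟩
      have hJB : ∀ z ∈ J a, z.unop ∈ augPart (Subalgebra.toSubmodule B) * ⊤ := by
        intro z hz
        induction hz using Submodule.span_induction with
        | mem z hz =>
          obtain ⟨y, hy, rfl⟩ := hz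
          simpa using Submodule.mul_mem_mul (hf.mem_augPart hy)
            (Submodule.mem_top : (1 : H) ∈ (⊤ : Submodule k H))
        | zero => exact Submodule.zero_mem _
        | add y z _ _ hy hz => exact Submodule.add_mem _ hy hz
        | smul c z _ hz =>
          rw [smul_eq_mul, MulOpposite.unop_mul]
          have := Submodule.mul_mem_mul hz (Submodule.mem_top : c.unop ∈ (⊤ : Submodule k H))
          rw [mul_assoc] at this
          exact (mul_le_mul' le_rfl le_top : _ ≤ augPart (Subalgebra.toSubmodule B) * ⊤) this
      have hinl : f (Sum.inl a) ∈ B :=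
        hf.mem_lowerSubmodule (x := Sum.inl a) hH
          (Submodule.mem_sup_right (hJB _ (not_not.1 haP)))
      rcases x with b | d
      · obtain rfl : b = a := hxa
        exact hle hinl
      -- From `1 - g ∈ B` follows `g ∈ B`, hence `S(g) ∈ B`. This is why `P` tests only original
      -- letters.
      · obtain rfl : (d : O) = a := hxa
        obtain ⟨g, hg, hdg⟩ := hf.exists_eq_one_sub
          (hf.degree_eq_zero (x := Sum.inl (d : O)) d.2)
        rw [hf.mirror, hdg, map_antipode_one_sub]
        rw [hdg] at hinl
        refine hle (B.sub_mem B.one_mem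
          ((hf.isInvertibleCoidealSubalgebra_lowerSubalgebra d).antipode_mem g ?_ hg))
        simpa using B.sub_mem B.one_mem hinl
  refine ⟨(Subalgebra.fg_def).2 ⟨_, hfin, ?_⟩⟩
  rw [← top_le_iff, ← hf.adjoin_range]
  refine Algebra.adjoin_le ?_
  rintro _ ⟨x, rfl⟩
  exact key _ x rfl

end IsAdaptedGeneratingSet

end Generators

end PointedHopf

namespace PointedHopf

/-! ### Construction of an adapted generating set -/

section Existence

variable (k : Type u) {H : Type v} [Field k] [Ring H] [HopfAlgebra k H]

/-- The least `n` such that `h` lies in the `n`-th term of the coradical filtration. -/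
noncomputable def coradicalDegree (h : H) : ℕ := sInf {n | h ∈ coradicalFiltration k H n}

variable {k}

lemma isLeast_coradicalDegree (hp : IsPointed k H) (h : H) :
    IsLeast {n | h ∈ coradicalFiltration k H n} (coradicalDegree k h) :=
  ⟨Nat.sInf_mem (exists_mem_coradicalFiltration hp h), fun _ hn => Nat.sInf_le hn⟩

lemma coradicalDegree_le {h : H} {n : ℕ} (hn : h ∈ coradicalFiltration k H n) :
    coradicalDegree k h ≤ n := Nat.sInf_le hn

lemma one_mem_coradicalFiltration (hp : IsPointed k H) (n : ℕ) :
    (1 : H) ∈ coradicalFiltration k H n :=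
  groupLike_mem_coradicalFiltration hp .one n

lemma coradicalDegree_one_sub (hp : IsPointed k H) {g : H} (hg : IsGroupLikeElem k g) :
    coradicalDegree k (1 - g) = 0 :=
  Nat.le_zero.1 <| coradicalDegree_le <| Submodule.sub_mem _ (one_mem_coradicalFiltration hp 0)
    (groupLike_mem_coradicalFiltration hp hg 0)

variable (k) in
/-- The elements that serve as values of letters. -/
def IsAdapted (h : H) : Prop :=
  Coalgebra.counit (R := k) h = 0 ∧
  (coradicalDegree k h = 0 → ∃ g, IsGroupLikeElem k g ∧ h = 1 - g) ∧
  ∀ n, coradicalDegree k h = n + 1 → IsSkewModulo (coradicalFiltration k H n) h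

lemma isAdapted_one_sub (hp : IsPointed k H) {g : H} (hg : IsGroupLikeElem k g) :
    IsAdapted k (1 - g) :=
  ⟨by simp [hg.counit_eq_one], fun _ => ⟨g, hg, rfl⟩,
    fun n hn => by simp [coradicalDegree_one_sub hp hg] at hn⟩

/-- The adapted elements span the augmentation part of the coradical filtration. -/
lemma sub_counit_mem_span_isAdapted (hp : IsPointed k H) (n : ℕ) {h : H}
    (hh : h ∈ coradicalFiltration k H n) :
    h - Coalgebra.counit (R := k) h • (1 : H) ∈
      Submodule.span k {w : H | IsAdapted k w ∧ coradicalDegree k w ≤ n} := by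
  set T : ℕ → Submodule k H :=
    fun n => Submodule.span k {w : H | IsAdapted k w ∧ coradicalDegree k w ≤ n} with hT
  let p : H →ₗ[k] H := LinearMap.id -
    (LinearMap.toSpanSingleton k H 1) ∘ₗ Coalgebra.counit (R := k) (A := H)
  have hpa : ∀ x, p x = x - Coalgebra.counit (R := k) x • (1 : H) := fun x => rfl
  rw [← hpa]
  change p h ∈ T n
  induction n generalizing h with
  | zero =>
    rw [mem_coradicalFiltration_zero hp] at hh
    have : Submodule.span k {g : H | IsGroupLikeElem k g} ≤ (T 0).comap p := by
      refine Submodule.span_le.2 fun g (hg : IsGroupLikeElem k g) => ?_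
      have h1 : p g = -(1 - g) := by rw [hpa, hg.counit_eq_one, one_smul, neg_sub]
      rw [SetLike.mem_coe, Submodule.mem_comap, h1]
      exact Submodule.neg_mem _ (Submodule.subset_span
        ⟨isAdapted_one_sub hp hg, (coradicalDegree_one_sub hp hg).le⟩)
    exact this hh
  | succ n ih =>
    have hle : T n ≤ T (n + 1) :=
      Submodule.span_mono fun w hw => ⟨hw.1, hw.2.trans n.le_succ⟩
    have h1 := mem_span_isSkewModulo ((mem_coradicalFiltration_succ' hp).1 hh)
    refine (Submodule.span_le.2 ?_ : _ ≤ (T (n + 1)).comap p) h1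
    rintro w (hw | ⟨⟨φ, rfl⟩, g, hg, hw⟩)
    · exact hle (ih hw)
    set w := lact φ h with hwdef
    have hwn : w ∈ coradicalFiltration k H (n + 1) :=
      isLeftCoideal_coradicalFiltration hp _ φ h hh
    have h1n := one_mem_coradicalFiltration hp n
    have hpw : Coalgebra.counit (R := k) (p w) = 0 := by simp [hpa]
    have hpp : p (p w) = p w := by rw [hpa (p w), hpw, zero_smul, sub_zero]
    change p w ∈ T (n + 1)
    -- Removing the counit may lower the degree of `w`; then induction applies. Otherwise `p w` is
    -- itself adapted, with the same `g`, because `w` changes only by a multiple of `1`, which lies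
    -- in term `n`.
    by_cases hpn : p w ∈ coradicalFiltration k H n
    · rw [← hpp]
      exact hle (ih hpn)
    have hpn1 : p w ∈ coradicalFiltration k H (n + 1) := by
      rw [hpa]
      exact Submodule.sub_mem _ hwn
        (Submodule.smul_mem _ _ (one_mem_coradicalFiltration hp (n + 1)))
    have hdeg : coradicalDegree k (p w) = n + 1 := by
      refine le_antisymm (coradicalDegree_le hpn1) (Nat.succ_le_of_lt (lt_of_not_ge fun hle => ?_))
      exact hpn (coradicalFiltration_mono hp hle (isLeast_coradicalDegree hp _).1)
    refine Submodule.subset_span ⟨⟨hpw, fun h0 => by omega, fun m hm => ?_⟩, hdeg.le⟩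
    obtain rfl : n = m := by omega
    refine ⟨g, hg, fun φ => ?_⟩
    have h2 : lact φ (p w) - φ g • p w = (lact φ w - φ g • w) -
        Coalgebra.counit (R := k) w • (φ 1 - φ g) • (1 : H) := by
      have h3 : lact φ (1 : H) = φ 1 • 1 := (IsGroupLikeElem.one (R := k)).lact_eq φ
      rw [hpa, map_sub, map_smul, h3, smul_sub, sub_smul, smul_sub, smul_comm (φ g)]
      abel
    rw [h2]
    exact Submodule.sub_mem _ (hw φ) (Submodule.smul_mem _ _ (Submodule.smul_mem _ _ h1n))

lemma isOfFinOrder_antipode {g : H} (hg : IsGroupLikeElem k g) :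
    IsOfFinOrder (HopfAlgebra.antipode k g) ↔ IsOfFinOrder g := by
  have h1 : ∀ x : GroupLike k H, IsOfFinOrder x.val ↔ IsOfFinOrder x := fun x => by
    simp only [isOfFinOrder_iff_pow_eq_one, ← GroupLike.val_pow, ← GroupLike.val_one (R := k),
      GroupLike.val_inj]
  exact (h1 (⟨g, hg⟩ : GroupLike k H)⁻¹).trans (isOfFinOrder_inv_iff.trans (h1 ⟨g, hg⟩).symm)

lemma antipode_ne_self {g : H} (hg : IsGroupLikeElem k g) (hfin : ¬ IsOfFinOrder g) :
    HopfAlgebra.antipode k g ≠ g := fun h =>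
  hfin <| isOfFinOrder_iff_pow_eq_one.2 ⟨2, two_pos, by
    rw [pow_two]
    nth_rewrite 1 [← h]
    exact hg.antipode_mul_cancel⟩

variable (k) in
/-- `h = 1 - g` with `g` of infinite order, and `h` precedes `1 - g⁻¹` in a fixed well-order. -/
def IsFirstOfPair (h : H) : Prop :=
  ∃ g, IsGroupLikeElem k g ∧ ¬ IsOfFinOrder g ∧ h = 1 - g ∧
    WellOrderingRel (1 - g) (1 - HopfAlgebra.antipode k g)

variable (k) in
/-- `h = 1 - g` with `g` of infinite order, and `1 - g⁻¹` precedes `h` in a fixed well-order. -/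
def IsSecondOfPair (h : H) : Prop :=
  ∃ g, IsGroupLikeElem k g ∧ ¬ IsOfFinOrder g ∧ h = 1 - g ∧
    WellOrderingRel (1 - HopfAlgebra.antipode k g) (1 - g)

lemma IsFirstOfPair.not_isSecondOfPair {h : H} (hh : IsFirstOfPair k h) :
    ¬ IsSecondOfPair k h := by
  rintro ⟨g, hg, -, rfl, hlt⟩
  obtain ⟨g', hg', -, hgg', hlt'⟩ := hh
  obtain rfl := sub_right_injective hgg'
  exact asymm hlt hlt'

lemma isFirstOfPair_antipode {h : H} :
    IsFirstOfPair k h → IsSecondOfPair k (HopfAlgebra.antipode k h) ∧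
      HopfAlgebra.antipode k (HopfAlgebra.antipode k h) = h := by
  rintro ⟨g, hg, hfin, rfl, hlt⟩
  rw [map_antipode_one_sub, map_antipode_one_sub, hg.antipode_antipode]
  refine ⟨⟨_, hg.antipode, by rwa [isOfFinOrder_antipode hg], rfl, ?_⟩, rfl⟩
  rwa [hg.antipode_antipode]

lemma isSecondOfPair_antipode {h : H} :
    IsSecondOfPair k h → IsFirstOfPair k (HopfAlgebra.antipode k h) ∧
      HopfAlgebra.antipode k (HopfAlgebra.antipode k h) = h := by
  rintro ⟨g, hg, hfin, rfl, hlt⟩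
  rw [map_antipode_one_sub, map_antipode_one_sub, hg.antipode_antipode]
  refine ⟨⟨_, hg.antipode, by rwa [isOfFinOrder_antipode hg], rfl, ?_⟩, rfl⟩
  rwa [hg.antipode_antipode]

lemma isFirst_or_isSecond {g : H} (hg : IsGroupLikeElem k g) (hfin : ¬ IsOfFinOrder g) :
    IsFirstOfPair k (1 - g) ∨ IsSecondOfPair k (1 - g) := by
  rcases trichotomous_of WellOrderingRel (1 - g) (1 - HopfAlgebra.antipode k g) with h | h | h
  · exact Or.inl ⟨g, hg, hfin, rfl, h⟩
  · exact absurd (sub_right_injective h).symm (antipode_ne_self hg hfin)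
  · exact Or.inr ⟨g, hg, hfin, rfl, h⟩

lemma IsFirstOfPair.exists_groupLike {h : H} (hh : IsFirstOfPair k h) :
    ∃ g, IsGroupLikeElem k g ∧ ¬ IsOfFinOrder g ∧ h = 1 - g :=
  let ⟨g, h1, h2, h3, _⟩ := hh; ⟨g, h1, h2, h3⟩

lemma IsSecondOfPair.exists_groupLike {h : H} (hh : IsSecondOfPair k h) :
    ∃ g, IsGroupLikeElem k g ∧ ¬ IsOfFinOrder g ∧ h = 1 - g :=
  let ⟨g, h1, h2, h3, _⟩ := hh; ⟨g, h1, h2, h3⟩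

variable (k H) in
/-- The original letters: adapted elements, with one element of each mirror pair omitted. -/
abbrev OriginalLetter : Type v := {h : H // IsAdapted k h ∧ ¬ IsSecondOfPair k h}

/-- Original letters are ordered by degree first. -/
noncomputable instance : LinearOrder (OriginalLetter k H) :=
  letI : LinearOrder H := IsWellOrder.linearOrder WellOrderingRel
  LinearOrder.lift' (fun x : OriginalLetter k H => toLex (coradicalDegree k x.1, x.1))
    fun _ _ h => Subtype.ext (congrArg (fun z => (ofLex z).2) h)

lemma lt_of_coradicalDegree_lt {x y : OriginalLetter k H}
    (h : coradicalDegree k x.1 < coradicalDegree k y.1) : x < y :=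
  letI : LinearOrder H := IsWellOrder.linearOrder WellOrderingRel
  show toLex (coradicalDegree k x.1, x.1) < toLex (coradicalDegree k y.1, y.1) from
    Prod.Lex.toLex_lt_toLex.2 (Or.inl h)

instance : WellFoundedLT (OriginalLetter k H) :=
  letI : LinearOrder H := IsWellOrder.linearOrder WellOrderingRel
  haveI : WellFoundedLT H := ⟨(WellOrderingRel.isWellOrder (α := H)).wf⟩
  ⟨InvImage.wf (fun x : OriginalLetter k H => toLex (coradicalDegree k x.1, x.1))
    (wellFounded_lt (α := ℕ ×ₗ H))⟩

variable (k H) in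
/-- The original letters that have a mirror letter. -/
def mirroredLetters : Set (OriginalLetter k H) := {x | IsFirstOfPair k x.1}

variable (k H) in
/-- The value of a letter. -/
noncomputable def letterValue : Letter (mirroredLetters k H) → H
  | Sum.inl x => x.1
  | Sum.inr x => HopfAlgebra.antipode k x.1.1

lemma letterValue_injective : Function.Injective (letterValue k H) := by
  rintro (x | x) (y | y) hxy
  · exact congrArg Sum.inl (Subtype.ext hxy)
  · refine absurd (isFirstOfPair_antipode y.2).1 ?_
    rw [← show x.1 = HopfAlgebra.antipode k y.1.1 from hxy]
    exact x.2.2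
  · refine absurd (isFirstOfPair_antipode x.2).1 ?_
    rw [show HopfAlgebra.antipode k x.1.1 = y.1 from hxy]
    exact y.2.2
  · refine congrArg Sum.inr (Subtype.ext (Subtype.ext ?_))
    rw [← (isFirstOfPair_antipode x.2).2, ← (isFirstOfPair_antipode y.2).2]
    exact congrArg _ hxy

lemma isAdapted_letterValue (hp : IsPointed k H) (x : Letter (mirroredLetters k H)) :
    IsAdapted k (letterValue k H x) := by
  rcases x with x | x
  · exact x.2.1
  · obtain ⟨g, hg, -, h⟩ := (isFirstOfPair_antipode x.2).1.exists_groupLike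
    change IsAdapted k (HopfAlgebra.antipode k x.1.1)
    rw [h]
    exact isAdapted_one_sub hp hg

/-- The omitted member of each pair is recovered as the antipode of the retained one, since `S² =
id` on these elements. -/
lemma exists_letterValue_eq (hp : IsPointed k H) {h : H} (hh : IsAdapted k h) :
    ∃ x, letterValue k H x = h ∧
      (IsFirstOfPair k h ∨ IsSecondOfPair k h → orig x ∈ mirroredLetters k H) := by
  by_cases h2 : IsSecondOfPair k h
  · obtain ⟨h3, h4⟩ := isSecondOfPair_antipode h2
    obtain ⟨g, hg, -, hgh⟩ := h3.exists_groupLike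
    exact ⟨Sum.inr ⟨⟨HopfAlgebra.antipode k h, hgh ▸ isAdapted_one_sub hp hg,
      h3.not_isSecondOfPair⟩, h3⟩, h4, fun _ => h3⟩
  · exact ⟨Sum.inl ⟨h, hh, h2⟩, rfl, fun h1 => h1.resolve_right h2⟩

lemma coradicalDegree_letterValue (hp : IsPointed k H) (x : Letter (mirroredLetters k H)) :
    coradicalDegree k (letterValue k H x) = coradicalDegree k (orig x).1 := by
  rcases x with x | x
  · rfl
  · obtain ⟨g, hg, -, h⟩ := (isFirstOfPair_antipode x.2).1.exists_groupLike
    obtain ⟨g', hg', -, h'⟩ := IsFirstOfPair.exists_groupLike x.2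
    change coradicalDegree k (HopfAlgebra.antipode k x.1.1) = coradicalDegree k x.1.1
    rw [h, h', coradicalDegree_one_sub hp hg, coradicalDegree_one_sub hp hg']

lemma sub_counit_mem_span_letterValue (hp : IsPointed k H) {n : ℕ} {h : H}
    (hh : h ∈ coradicalFiltration k H n) :
    h - Coalgebra.counit (R := k) h • (1 : H) ∈
      Submodule.span k (letterValue k H '' {y | coradicalDegree k (letterValue k H y) < n + 1}) := by
  refine Submodule.span_mono ?_ (sub_counit_mem_span_isAdapted hp n hh)
  rintro w ⟨hw, hn⟩
  obtain ⟨x, rfl, -⟩ := exists_letterValue_eq hp hw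
  exact ⟨x, Nat.lt_succ_of_le hn, rfl⟩

lemma dual_lslice (φ ψ : Module.Dual k H) (t : H ⊗[k] H) : ψ (lslice φ t) = φ (rslice ψ t) := by
  induction t with
  | zero => simp
  | tmul a b => simp [mul_comm]
  | add s t hs ht => simp [hs, ht]

lemma isAdaptedGeneratingSet_letterValue (hp : IsPointed k H) :
    IsAdaptedGeneratingSet k (letterValue k H)
      (fun x => coradicalDegree k (letterValue k H x)) where
  injective := letterValue_injective
  adjoin_range := by
    refine top_le_iff.1 fun h _ => ?_
    obtain ⟨n, hn⟩ := exists_mem_coradicalFiltration hp h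
    have h1 : Submodule.span k
        (letterValue k H '' {y | coradicalDegree k (letterValue k H y) < n + 1}) ≤
        Subalgebra.toSubmodule (Algebra.adjoin k (Set.range (letterValue k H))) :=
      Submodule.span_le.2 ((Set.image_subset_range _ _).trans Algebra.subset_adjoin)
    have h2 := add_mem (h1 (sub_counit_mem_span_letterValue hp hn))
      (Subalgebra.smul_mem _ (Subalgebra.one_mem _) (Coalgebra.counit (R := k) h))
    rwa [sub_add_cancel] at h2
  counit_eq_zero x := (isAdapted_letterValue hp x).1
  degree x := isLeast_coradicalDegree hp _
  image_degree_zero := by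
    ext h
    constructor
    · rintro ⟨x, hx, rfl⟩
      exact (isAdapted_letterValue hp x).2.1 hx
    · rintro ⟨g, hg, rfl⟩
      obtain ⟨x, hx, -⟩ := exists_letterValue_eq hp (isAdapted_one_sub hp hg)
      exact ⟨x, by rw [Set.mem_ofPred_eq, hx, coradicalDegree_one_sub hp hg], hx⟩
  image_infinite_order := by
    ext h
    constructor
    · rintro ⟨x | x, hx, rfl⟩
      · exact IsFirstOfPair.exists_groupLike hx
      · exact (isFirstOfPair_antipode hx).1.exists_groupLike
    · rintro ⟨g, hg, hfin, rfl⟩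
      obtain ⟨x, hx, hx'⟩ := exists_letterValue_eq hp (isAdapted_one_sub hp hg)
      exact ⟨x, hx' (isFirst_or_isSecond hg hfin), hx⟩
  mirror _ := rfl
  lt_of_degree_lt x y hxy := by
    simp only [coradicalDegree_letterValue hp] at hxy
    exact Or.inl (lt_of_coradicalDegree_lt hxy)
  comul x := by
    obtain ⟨hε, h0, hs⟩ := isAdapted_letterValue hp x
    rcases hdeg : coradicalDegree k (letterValue k H x) with _ | n
    · obtain ⟨g, hg, hx⟩ := h0 hdeg
      refine ⟨g, hg, ?_⟩
      rw [hx, map_sub, hg.comul_eq_tmul_self, Bialgebra.comul_one,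
        Algebra.TensorProduct.one_def, TensorProduct.sub_tmul, TensorProduct.tmul_sub]
      convert Submodule.zero_mem _ using 1
      abel
    · obtain ⟨g, hg, hgx⟩ := hs n hdeg
      refine ⟨g, hg, mem_tensorSub.2 ⟨mem_tensorSub_top_right.2 fun φ => ?_,
        mem_tensorSub_top_left.2 fun φ => ?_⟩⟩
      -- Applying `ε` to the left factor gives `h - ε(h)1 - ε(g)h = 0`.
      · rw [LinearMap.mem_ker, ← dual_lslice, map_sub (lslice _), map_sub (lslice _),
          ← lact_apply, lact_counit,
          lslice_tmul, lslice_tmul, hε, hg.counit_eq_one]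
        simp
      · rw [map_sub, map_sub, ← lact_apply, lslice_tmul, lslice_tmul]
        set h := letterValue k H x
        -- This slice has counit `φ(h) - φ(h) - φ(g)ε(h) = 0`, so letters of degree at most `n` span
        -- it with no constant term.
        have h1 : lact φ h - φ h • (1 : H) - φ g • h ∈ coradicalFiltration k H n := by
          rw [sub_right_comm]
          exact Submodule.sub_mem _ (hgx φ)
            (Submodule.smul_mem _ _ (one_mem_coradicalFiltration hp n))
        have h2 := sub_counit_mem_span_letterValue hp h1
        rw [map_sub, map_sub, counit_lact, map_smul, map_smul, hε, Bialgebra.counit_one] at h2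
        simpa using h2

end Existence

end PointedHopf

namespace PointedHopf

/-! ### The opposite co-opposite Hopf algebra -/

section OpCop

/-- The Hopf algebra with opposite multiplication and opposite comultiplication. -/
def OpCop (H : Type*) : Type _ := Hᵐᵒᵖ

variable (k : Type*) {H : Type*} [Field k] [Ring H]

noncomputable instance : Ring (OpCop H) := inferInstanceAs (Ring Hᵐᵒᵖ)

noncomputable instance [Algebra k H] : Algebra k (OpCop H) := inferInstanceAs (Algebra k Hᵐᵒᵖ)

section

variable [Algebra k H]

variable (H) in
/-- The identity map to the opposite Hopf algebra. -/
noncomputable def opCop : H ≃ₗ[k] OpCop H := MulOpposite.opLinearEquiv k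

lemma opCop_mul (a b : H) : opCop k H (a * b) = opCop k H b * opCop k H a := rfl

lemma opCop_one : opCop k H 1 = 1 := rfl

lemma opCop_algebraMap (r : k) : opCop k H (algebraMap k H r) = algebraMap k (OpCop H) r := rfl

variable (H) in
/-- The flip `a ⊗ b ↦ b ⊗ a`. -/
noncomputable def flipOpCop : H ⊗[k] H →ₗ[k] OpCop H ⊗[k] OpCop H :=
  TensorProduct.map (opCop k H).toLinearMap (opCop k H).toLinearMap ∘ₗ
    (TensorProduct.comm k H H).toLinearMap

@[simp] lemma flipOpCop_tmul (a b : H) :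
    flipOpCop k H (a ⊗ₜ[k] b) = opCop k H b ⊗ₜ[k] opCop k H a := by
  simp [flipOpCop]

variable (H) in
/-- The reversal of triple tensors. -/
noncomputable def reverseOpCop :
    H ⊗[k] (H ⊗[k] H) →ₗ[k] OpCop H ⊗[k] (OpCop H ⊗[k] OpCop H) :=
  (TensorProduct.assoc k _ _ _).toLinearMap ∘ₗ
    TensorProduct.map (flipOpCop k H) (opCop k H).toLinearMap ∘ₗ
    (TensorProduct.comm k H (H ⊗[k] H)).toLinearMap

@[simp] lemma reverseOpCop_tmul (a b c : H) :
    reverseOpCop k H (a ⊗ₜ[k] (b ⊗ₜ[k] c)) =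
      opCop k H c ⊗ₜ[k] (opCop k H b ⊗ₜ[k] opCop k H a) := by
  simp [reverseOpCop]

lemma flipOpCop_mul (s t : H ⊗[k] H) :
    flipOpCop k H (s * t) = flipOpCop k H t * flipOpCop k H s := by
  induction s with
  | zero => simp
  | add s s' hs hs' => rw [add_mul, map_add, hs, hs', map_add, mul_add]
  | tmul a b =>
    induction t with
    | zero => simp
    | add t t' ht ht' => rw [mul_add, map_add, ht, ht', map_add, add_mul]
    | tmul c d => simp [opCop_mul]

end

variable [HopfAlgebra k H]

noncomputable instance : CoalgebraStruct k (OpCop H) where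
  comul := flipOpCop k H ∘ₗ Coalgebra.comul ∘ₗ (opCop k H).symm.toLinearMap
  counit := Coalgebra.counit ∘ₗ (opCop k H).symm.toLinearMap

lemma comul_opCop (h : H) :
    Coalgebra.comul (R := k) (opCop k H h) = flipOpCop k H (Coalgebra.comul h) := by
  change flipOpCop k H (Coalgebra.comul ((opCop k H).symm (opCop k H h))) = _
  rw [LinearEquiv.symm_apply_apply]

lemma counit_opCop (h : H) :
    Coalgebra.counit (R := k) (opCop k H h) = Coalgebra.counit (R := k) h := by
  change Coalgebra.counit ((opCop k H).symm (opCop k H h)) = _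
  rw [LinearEquiv.symm_apply_apply]

lemma assoc_rTensor_flipOpCop (t : H ⊗[k] H) :
    TensorProduct.assoc k _ _ _
      ((Coalgebra.comul (R := k) (A := OpCop H)).rTensor _ (flipOpCop k H t)) =
      reverseOpCop k H ((Coalgebra.comul (R := k) (A := H)).lTensor _ t) := by
  induction t with
  | zero => simp
  | add s t hs ht => simp only [map_add, hs, ht]
  | tmul a b =>
    rw [flipOpCop_tmul, LinearMap.rTensor_tmul, LinearMap.lTensor_tmul, comul_opCop]
    induction (Coalgebra.comul b : H ⊗[k] H) with
    | zero => simp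
    | add s t hs ht => simp only [map_add, TensorProduct.add_tmul, TensorProduct.tmul_add, hs, ht]
    | tmul c d => simp

lemma lTensor_flipOpCop (t : H ⊗[k] H) :
    (Coalgebra.comul (R := k) (A := OpCop H)).lTensor _ (flipOpCop k H t) =
      reverseOpCop k H (TensorProduct.assoc k _ _ _
        ((Coalgebra.comul (R := k) (A := H)).rTensor _ t)) := by
  induction t with
  | zero => simp
  | add s t hs ht => simp only [map_add, hs, ht]
  | tmul a b =>
    rw [flipOpCop_tmul, LinearMap.rTensor_tmul, LinearMap.lTensor_tmul, comul_opCop]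
    induction (Coalgebra.comul a : H ⊗[k] H) with
    | zero => simp
    | add s t hs ht => simp only [map_add, TensorProduct.add_tmul, TensorProduct.tmul_add, hs, ht]
    | tmul c d => simp

lemma rTensor_counit_flipOpCop (t : H ⊗[k] H) :
    (Coalgebra.counit (R := k) (A := OpCop H)).rTensor _ (flipOpCop k H t) =
      1 ⊗ₜ[k] opCop k H (rslice Coalgebra.counit t) := by
  induction t with
  | zero => simp
  | add s t hs ht => simp only [map_add, hs, ht, TensorProduct.tmul_add]
  | tmul a b =>
    rw [flipOpCop_tmul, LinearMap.rTensor_tmul, counit_opCop, rslice_tmul, map_smul,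
      ← TensorProduct.smul_tmul, smul_eq_mul, mul_one]

lemma lTensor_counit_flipOpCop (t : H ⊗[k] H) :
    (Coalgebra.counit (R := k) (A := OpCop H)).lTensor _ (flipOpCop k H t) =
      opCop k H (lslice Coalgebra.counit t) ⊗ₜ[k] 1 := by
  induction t with
  | zero => simp
  | add s t hs ht => simp only [map_add, hs, ht, TensorProduct.add_tmul]
  | tmul a b =>
    rw [flipOpCop_tmul, LinearMap.lTensor_tmul, counit_opCop, lslice_tmul, map_smul,
      TensorProduct.smul_tmul, smul_eq_mul, mul_one]

noncomputable instance : Coalgebra k (OpCop H) where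
  coassoc := by
    ext x
    obtain ⟨h, rfl⟩ := (opCop k H).surjective x
    simp only [LinearMap.comp_apply, comul_opCop, LinearEquiv.coe_coe]
    rw [assoc_rTensor_flipOpCop, lTensor_flipOpCop, Coalgebra.coassoc_apply]
  rTensor_counit_comp_comul := by
    ext x
    obtain ⟨h, rfl⟩ := (opCop k H).surjective x
    rw [LinearMap.comp_apply, comul_opCop, rTensor_counit_flipOpCop, ← ract_apply, ract_counit]
    rfl
  lTensor_counit_comp_comul := by
    ext x
    obtain ⟨h, rfl⟩ := (opCop k H).surjective x
    rw [LinearMap.comp_apply, comul_opCop, lTensor_counit_flipOpCop, ← lact_apply, lact_counit]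
    rfl

noncomputable instance : Bialgebra k (OpCop H) :=
  Bialgebra.mk' k (OpCop H)
    (by rw [← opCop_one k, counit_opCop, Bialgebra.counit_one])
    (by
      intro a b
      obtain ⟨a, rfl⟩ := (opCop k H).surjective a
      obtain ⟨b, rfl⟩ := (opCop k H).surjective b
      rw [← opCop_mul, counit_opCop, counit_opCop, counit_opCop, Bialgebra.counit_mul, mul_comm])
    (by
      rw [← opCop_one k, comul_opCop, Bialgebra.comul_one, Algebra.TensorProduct.one_def,
        flipOpCop_tmul, opCop_one, Algebra.TensorProduct.one_def])
    (by
      intro a b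
      obtain ⟨a, rfl⟩ := (opCop k H).surjective a
      obtain ⟨b, rfl⟩ := (opCop k H).surjective b
      rw [← opCop_mul, comul_opCop, comul_opCop, comul_opCop, Bialgebra.comul_mul, flipOpCop_mul])

variable (H) in
/-- The antipode of the opposite Hopf algebra. -/
noncomputable def antipodeOpCop : OpCop H →ₗ[k] OpCop H :=
  (opCop k H).toLinearMap ∘ₗ HopfAlgebra.antipode k ∘ₗ (opCop k H).symm.toLinearMap

lemma antipodeOpCop_apply (h : H) :
    antipodeOpCop k H (opCop k H h) = opCop k H (HopfAlgebra.antipode k h) := by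
  simp [antipodeOpCop]

lemma mul_rTensor_flipOpCop (t : H ⊗[k] H) :
    LinearMap.mul' k (OpCop H) ((antipodeOpCop k H).rTensor _ (flipOpCop k H t)) =
      opCop k H (LinearMap.mul' k H ((HopfAlgebra.antipode k).lTensor H t)) := by
  induction t with
  | zero => simp
  | add s t hs ht => simp only [map_add, hs, ht]
  | tmul a b => simp [antipodeOpCop_apply, opCop_mul]

lemma mul_lTensor_flipOpCop (t : H ⊗[k] H) :
    LinearMap.mul' k (OpCop H) ((antipodeOpCop k H).lTensor _ (flipOpCop k H t)) =
      opCop k H (LinearMap.mul' k H ((HopfAlgebra.antipode k).rTensor H t)) := by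
  induction t with
  | zero => simp
  | add s t hs ht => simp only [map_add, hs, ht]
  | tmul a b => simp [antipodeOpCop_apply, opCop_mul]

noncomputable instance : HopfAlgebra k (OpCop H) where
  antipode := antipodeOpCop k H
  mul_antipode_rTensor_comul := by
    ext x
    obtain ⟨h, rfl⟩ := (opCop k H).surjective x
    rw [LinearMap.comp_apply, LinearMap.comp_apply, LinearMap.comp_apply, comul_opCop,
      mul_rTensor_flipOpCop, HopfAlgebra.mul_antipode_lTensor_comul_apply, opCop_algebraMap,
      counit_opCop, Algebra.linearMap_apply]
  mul_antipode_lTensor_comul := by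
    ext x
    obtain ⟨h, rfl⟩ := (opCop k H).surjective x
    rw [LinearMap.comp_apply, LinearMap.comp_apply, LinearMap.comp_apply, comul_opCop,
      mul_lTensor_flipOpCop, HopfAlgebra.mul_antipode_rTensor_comul_apply, opCop_algebraMap,
      counit_opCop, Algebra.linearMap_apply]

variable {k}

lemma lslice_flipOpCop (φ : Module.Dual k (OpCop H)) (t : H ⊗[k] H) :
    lslice φ (flipOpCop k H t) = opCop k H (rslice (φ ∘ₗ (opCop k H).toLinearMap) t) := by
  induction t with
  | zero => simp
  | add s t hs ht => simp only [map_add, hs, ht]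
  | tmul a b => simp

lemma rslice_flipOpCop (φ : Module.Dual k (OpCop H)) (t : H ⊗[k] H) :
    rslice φ (flipOpCop k H t) = opCop k H (lslice (φ ∘ₗ (opCop k H).toLinearMap) t) := by
  induction t with
  | zero => simp
  | add s t hs ht => simp only [map_add, hs, ht]
  | tmul a b => simp

/-- Reversal exchanges left and right coideals and keeps the group-like elements, so the symmetric
criterion `isPointed_iff` transfers. With both structures reversed, the same antipode still works,
with no need for it to be bijective. -/
lemma isPointed_opCop (hp : IsPointed k H) : IsPointed k (OpCop H) := by
  rw [isPointed_iff] at hp ⊢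
  intro E hE hl hr
  have hφ : ∀ φ : Module.Dual k H,
      (φ ∘ₗ (opCop k H).symm.toLinearMap) ∘ₗ (opCop k H).toLinearMap = φ := fun φ => by
    ext x; simp
  have hbot : E.comap (opCop k H).toLinearMap ≠ ⊥ := by
    intro h
    obtain ⟨e, he, he0⟩ := E.ne_bot_iff.1 hE
    obtain ⟨x, rfl⟩ := (opCop k H).surjective e
    have hx : x ∈ E.comap (opCop k H).toLinearMap := he
    rw [h, Submodule.mem_bot] at hx
    exact he0 (by rw [hx, map_zero])
  have hleft : IsLeftCoideal (E.comap (opCop k H).toLinearMap) := by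
    intro φ x hx
    have h := hr (φ ∘ₗ (opCop k H).symm.toLinearMap) _ hx
    rwa [LinearEquiv.coe_coe, ract_apply, comul_opCop, rslice_flipOpCop, hφ] at h
  have hright : IsRightCoideal (E.comap (opCop k H).toLinearMap) := by
    intro φ x hx
    have h := hl (φ ∘ₗ (opCop k H).symm.toLinearMap) _ hx
    rwa [LinearEquiv.coe_coe, lact_apply, comul_opCop, lslice_flipOpCop, hφ] at h
  obtain ⟨g, hg, hgl⟩ := hp _ hbot hleft hright
  refine ⟨opCop k H g, hg, by rw [counit_opCop, hgl.counit_eq_one], ?_⟩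
  rw [comul_opCop, hgl.comul_eq_tmul_self, flipOpCop_tmul]

lemma finiteType_of_opCop (h : Algebra.FiniteType k (OpCop H)) : Algebra.FiniteType k H := by
  obtain ⟨s, hs⟩ := h
  refine ⟨Subalgebra.fg_def.2 ⟨(opCop k H).symm '' s, s.finite_toSet.image _, ?_⟩⟩
  refine top_le_iff.1 fun x _ => ?_
  have hx : opCop k H x ∈ Algebra.adjoin k (s : Set (OpCop H)) := hs ▸ Algebra.mem_top
  rw [← (opCop k H).symm_apply_apply x]
  generalize opCop k H x = y at hx
  induction hx using Algebra.adjoin_induction with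
  | mem y hy => exact Algebra.subset_adjoin ⟨y, hy, rfl⟩
  | algebraMap r => exact Subalgebra.algebraMap_mem _ r
  | add y z _ _ hy hz => rw [map_add]; exact add_mem hy hz
  | mul y z _ _ hy hz => exact mul_mem hz hy

end OpCop

lemma finiteType_of_isNoetherianRing_op {k : Type u} {H : Type v} [Field k] [Ring H]
    [HopfAlgebra k H] (hp : IsPointed k H) [IsNoetherianRing Hᵐᵒᵖ] : Algebra.FiniteType k H :=
  (isAdaptedGeneratingSet_letterValue hp).finiteType_of_isNoetherianRing_mulOpposite
    (isPointed_iff.1 hp)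

end PointedHopf

theorem theoremB {k : Type u} {H : Type v} [Field k] [Ring H] [HopfAlgebra k H]
    (hpointed : PointedHopf.IsPointed k H) :
    (∃ (O : Type v) (_ : LinearOrder O) (_ : WellFoundedLT O) (D : Set O)
        (f : PointedHopf.Letter D → H) (t : PointedHopf.Letter D → ℕ),
      PointedHopf.IsAdaptedGeneratingSet k f t ∧
      Algebra.adjoin k ((fun x => FreeAlgebra.lift k f (FreeAlgebra.ι k x)) ''
        PointedHopf.irreducibleLetters (RingHom.ker (FreeAlgebra.lift k f))) = ⊤) ∧
    (IsNoetherianRing Hᵐᵒᵖ ∨ IsNoetherianRing H → Algebra.FiniteType k H) := by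
  have hf := PointedHopf.isAdaptedGeneratingSet_letterValue hpointed
  refine ⟨⟨PointedHopf.OriginalLetter k H, inferInstance, inferInstance, _, _, _, hf,
    hf.adjoin_irreducibleLetters (PointedHopf.isPointed_iff.1 hpointed)⟩, ?_⟩
  rintro (h | h)
  · exact PointedHopf.finiteType_of_isNoetherianRing_op hpointed
  -- The double opposite is `H` as a ring, so `H` left Noetherian means `OpCop H` right Noetherian.
  · have : IsNoetherianRing (PointedHopf.OpCop H)ᵐᵒᵖ :=
      isNoetherianRing_of_ringEquiv H (RingEquiv.opOp H)
    exact PointedHopf.finiteType_of_opCop (PointedHopf.finiteType_of_isNoetherianRing_op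
      (PointedHopf.isPointed_opCop hpointed))
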